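/- Let $H$ be a separable real Hilbert space and let $A$ be a nonnegative trace-class operator on $H$ whose nonzero eigenvalues, counted with multiplicity, are $\lambda_k = c\,k^{-\alpha}$, $k = 1, 2, \dots$, for some $c > 0$ and $\alpha > 1$. Let $\mu = N(0, A)$ be the centered Gaussian measure on $H$ with covariance operator $A$, and let $\Pi(\mu,\mu)$ be the set of Borel probability measures on $H \times H$ with both marginals equal to $\mu$. For $\varepsilon > 0$ let $\pi_\varepsilon$ be the entropic optimal transport coupling of $\mu$ with itself, that is, the minimizer over $\pi \in \Pi(\mu,\mu)$ of $$\int_{H \times H} \|x - y\|^2 \, \pi(dx\,dy) + 2 \varepsilon\, \mathrm{KL}(\pi \,\|\, \mu \otimes \mu),$$ and let $\pi_0$ be the optimal transport coupling of $\mu$ with itself, that is, the minimizer over $\pi \in \Pi(\mu,\mu)$ of $\int \|x-y\|^2 \, d\pi$. For $\varepsilon > 0$ and $x \ge 0$ put $$f_\varepsilon(x) = \frac{2x}{\sqrt{4x^2 + \varepsilon^2} + \varepsilon}, \qquad \delta_\varepsilon(x) = \begin{cases} 2 - \sqrt{2(1 + f_\varepsilon(x))}, & x > 0, \\ 0, &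 x = 0, \end{cases}$$ and let $\mathcal W_2$ be the 2-Wasserstein distance on $H \times H$ with the norm $\|(x,y)\|^2 = \|x\|^2 + \|y\|^2$. Then $\pi_\varepsilon$ (for every $\varepsilon > 0$) and $\pi_0$ exist and are unique, and $$\lim_{\varepsilon \downarrow 0} \frac{\mathcal W_2^2(\pi_\varepsilon, \pi_0)}{\varepsilon^{1 - 1/\alpha}} = 2 c^{1/\alpha} \int_0^\infty t^{-\alpha}\, \delta_1(t^{-\alpha}) \, dt,$$ where the integral converges and the right-hand side lies in $(0, \infty)$. -/

import Mathlib

open MeasureTheory Filter Topology Set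
open scoped ENNReal InnerProductSpace

/-- `π` is a coupling of `μ` and `ν`: its marginals are `μ` and `ν`. -/
def IsCoupling {X Y : Type*} [MeasurableSpace X] [MeasurableSpace Y]
    (π : Measure (X × Y)) (μ : Measure X) (ν : Measure Y) : Prop :=
  π.map Prod.fst = μ ∧ π.map Prod.snd = ν

/-- The quadratic transport cost `∫ d(x, y)² dπ(x, y)`, with values in `[0, ∞]`. -/
noncomputable def transportCost {X : Type*} [PseudoEMetricSpace X] [MeasurableSpace X]
    (π : Measure (X × X)) : ℝ≥0∞ :=
  ∫⁻ p, edist p.1 p.2 ^ 2 ∂π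

/-- The 2-Wasserstein distance, as an infimum over all couplings. -/
noncomputable def wasserstein2 {X : Type*} [PseudoEMetricSpace X] [MeasurableSpace X]
    (μ ν : Measure X) : ℝ≥0∞ :=
  (⨅ (π : Measure (X × X)) (_ : IsCoupling π μ ν), transportCost π) ^ (1 / 2 : ℝ)

/-- `π` solves the (unregularized) Kantorovich problem between `μ` and `ν`. -/
def IsOTCoupling {X : Type*} [PseudoEMetricSpace X] [MeasurableSpace X]
    (μ ν : Measure X) (π : Measure (X × X)) : Prop :=
  IsCoupling π μ ν ∧ ∀ π' : Measure (X × X), IsCoupling π' μ ν →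
    transportCost π ≤ transportCost π'

/-- The entropic cost `∫ d(x, y)² dπ(x, y) + 2 ε KL(π ‖ μ ⊗ ν)`. -/
noncomputable def entropicCost {X : Type*} [PseudoEMetricSpace X] [MeasurableSpace X]
    (ε : ℝ) (μ ν : Measure X) (π : Measure (X × X)) : ℝ≥0∞ :=
  transportCost π + ENNReal.ofReal (2 * ε) * InformationTheory.klDiv π (μ.prod ν)

/-- `π` solves the entropic optimal transport problem between `μ` and `ν`, the minimum being
over all couplings, Gaussian or not. -/
def IsEOTCoupling {X : Type*} [PseudoEMetricSpace X] [MeasurableSpace X]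
    (ε : ℝ) (μ ν : Measure X) (π : Measure (X × X)) : Prop :=
  IsCoupling π μ ν ∧ ∀ π' : Measure (X × X), IsCoupling π' μ ν →
    entropicCost ε μ ν π ≤ entropicCost ε μ ν π'

/-- The 2-Wasserstein distance between measures on `H × H`, where `H × H` carries the Hilbert
norm `‖(x, y)‖² = ‖x‖² + ‖y‖²` (the Mathlib norm on `H × H` itself is the maximum norm). -/
noncomputable def wasserstein2Prod {H : Type*} [NormedAddCommGroup H] [MeasurableSpace H]
    (π ρ : Measure (H × H)) : ℝ≥0∞ :=
  wasserstein2 (π.map (WithLp.toLp 2)) (ρ.map (WithLp.toLp 2))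

section Hilbert

variable {H : Type*} [NormedAddCommGroup H] [InnerProductSpace ℝ H] [CompleteSpace H]

/-- `A` is a nonnegative trace-class operator: it is self-adjoint, nonnegative, and the diagonal
sums `∑ ⟪e k, A (e k)⟫` along orthonormal sequences converge. -/
def IsPositiveTraceClass (A : H →L[ℝ] H) : Prop :=
  A.IsPositive ∧ ∀ e : ℕ → H, Orthonormal ℝ e → Summable fun k => ⟪e k, A (e k)⟫_ℝ

/-- The self-adjoint operator `A` is diagonalized as `∑ k, lam k • ⟪e k, ·⟫ e k` by some
orthonormal sequence `e`. If all `lam k` are nonzero, this says that `lam` lists the nonzero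
eigenvalues of `A` with their multiplicities; `A` may have a kernel. -/
def HasEigenvalueSequence (A : H →L[ℝ] H) (lam : ℕ → ℝ) : Prop :=
  ∃ e : ℕ → H, Orthonormal ℝ e ∧ (∀ k, A (e k) = lam k • e k) ∧
    ∀ x, (∀ k, ⟪e k, x⟫_ℝ = 0) → A x = 0

/-- `μ` is the centered Gaussian measure `N(0, A)` with covariance operator `A`. -/
def IsCenteredGaussian [MeasurableSpace H] [BorelSpace H] (μ : Measure H) (A : H →L[ℝ] H) :
    Prop :=
  ProbabilityTheory.IsGaussian μ ∧ ∫ x, x ∂μ = 0 ∧ ProbabilityTheory.covarianceOperator μ = A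

end Hilbert

/-- The spectral shrinkage function `f_ε(x) = 2x / (√(4x² + ε²) + ε)`. -/
noncomputable def spectralShrinkage (ε x : ℝ) : ℝ :=
  2 * x / (√(4 * x ^ 2 + ε ^ 2) + ε)

/-- The perturbation function `δ_ε` on `[0, ∞)`. -/
noncomputable def perturbation (ε x : ℝ) : ℝ :=
  if 0 < x then 2 - √(2 * (1 + spectralShrinkage ε x)) else 0

/-! ### Operators diagonal along an orthonormal sequence that need not span. -/

section DiagonalOperator

variable {H : Type*} [NormedAddCommGroup H] [InnerProductSpace ℝ H]

/-! Everything diagonalizes in the eigenbasis. Write `ρ_k = f_ε(λ_k)`, the positive root of `λ(1 -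
ρ²) = ερ`, and `R = diag(ρ_k)`. Tilting `μ ⊗ μ` by `exp L`, with `L = const - (⟪Rx,x⟫ + ⟪Ry,y⟫)/(2ε)
+ ⟪x,y⟫/ε`, makes `y` given `x` Gaussian with mean `Rx` and variances `λ_k(1 - ρ_k²)`
(`integral_cexp_eotExponent`), so the marginals are again `μ`. Since `‖x-y‖² + 2εL` splits into a
function of `x` plus a function of `y`, the entropic cost of a coupling `π` is a constant plus `2ε
KL(π ‖ π_ε)` (`entropicCost_eq`). This gives optimality and uniqueness. The unregularized optimum is
the diagonal coupling, as its cost is zero.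

To transport `π_ε` to the diagonal, send `(x, y)` to `(z, z)` with `z_k = (x_k + y_k)/a_k` and `a_k
= √(2(1 + ρ_k))`. Quadratic dual potentials, tight exactly there, show that this is optimal, whence
`W₂² = ∑ 2 λ_k δ_ε(λ_k)` (`wasserstein2Prod_eotCoupling_diag`).

As `δ_ε(x) = δ_1(x/ε)`, this series is, up to scaling, a Riemann sum of mesh `(ε/c)^(1/α)` for `g(t)
= t^(-α) δ_1(t^(-α))`. The function `g` is decreasing, bounded and integrable, so the sums converge
to its integral (`AntitoneOn.tendsto_mul_tsum`). -/

theorem Orthonormal.summable_inner_sq {e : ℕ → H} (he : Orthonormal ℝ e) (x : H) :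
    Summable fun k => ⟪e k, x⟫_ℝ ^ 2 := by
  simpa using he.inner_products_summable (x := x)

theorem Orthonormal.tsum_inner_sq_le {e : ℕ → H} (he : Orthonormal ℝ e) (x : H) :
    ∑' k, ⟪e k, x⟫_ℝ ^ 2 ≤ ‖x‖ ^ 2 := by
  simpa using he.tsum_inner_products_le (x := x)

theorem Orthonormal.summable_mul_inner_sq {e : ℕ → H} (he : Orthonormal ℝ e) {d : ℕ → ℝ} {C : ℝ}
    (hd : ∀ k, |d k| ≤ C) (x : H) : Summable fun k => d k * ⟪e k, x⟫_ℝ ^ 2 := by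
  refine ((he.summable_inner_sq x).mul_left C).of_norm_bounded fun k => ?_
  rw [norm_mul, Real.norm_eq_abs, Real.norm_eq_abs, abs_of_nonneg (sq_nonneg ⟪e k, x⟫_ℝ)]
  gcongr
  exact hd k

variable [CompleteSpace H]

/-- Orthogonal terms are summable as soon as their squared norms are, and Bessel's inequality bounds
those. -/
theorem Orthonormal.summable_diag {e : ℕ → H} (he : Orthonormal ℝ e) {d : ℕ → ℝ} {C : ℝ}
    (hd : ∀ k, |d k| ≤ C) (x : H) : Summable fun k => (d k * ⟪e k, x⟫_ℝ) • e k := by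
  have h := he.orthogonalFamily.summable_iff_norm_sq_summable (fun k => d k * ⟪e k, x⟫_ℝ)
  simp only [LinearIsometry.toSpanSingleton_apply] at h
  rw [h]
  refine ((he.summable_inner_sq x).mul_left (C ^ 2)).of_norm_bounded fun k => ?_
  rw [Real.norm_eq_abs, abs_of_nonneg (by positivity), norm_mul, mul_pow]
  simp only [Real.norm_eq_abs, sq_abs]
  have := sq_le_sq' (by linarith [neg_abs_le (d k), hd k, abs_nonneg (d k), hd k, abs_le.1 (hd k)])
    ((le_abs_self _).trans (hd k))
  gcongr

theorem Orthonormal.inner_tsum_diag {e : ℕ → H} (he : Orthonormal ℝ e) {d : ℕ → ℝ} {C : ℝ}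
    (hd : ∀ k, |d k| ≤ C) (x : H) (j : ℕ) :
    ⟪e j, ∑' k, (d k * ⟪e k, x⟫_ℝ) • e k⟫_ℝ = d j * ⟪e j, x⟫_ℝ := by
  have h := (innerSL ℝ (e j)).hasSum (he.summable_diag hd x).hasSum
  simp only [innerSL_apply_apply, inner_smul_right] at h
  rw [← h.tsum_eq, tsum_eq_single j fun k hk => by simp [he.inner_eq_zero hk.symm]]
  simp [he.1 j]

/-- The operator `x ↦ ∑ k, d k ⟪e k, x⟫ e k`, diagonal along the orthonormal sequence `e` with
bounded entries `d`. -/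
noncomputable def Orthonormal.diagOp {e : ℕ → H} (he : Orthonormal ℝ e) (d : ℕ → ℝ) (C : ℝ)
    (hd : ∀ k, |d k| ≤ C) : H →L[ℝ] H :=
  LinearMap.mkContinuous
    { toFun := fun x => ∑' k, (d k * ⟪e k, x⟫_ℝ) • e k
      map_add' := fun x y => by
        rw [← (he.summable_diag hd x).tsum_add (he.summable_diag hd y)]
        simp only [inner_add_right, mul_add, add_smul]
      map_smul' := fun c x => by
        rw [RingHom.id_apply, ← (he.summable_diag hd x).tsum_const_smul]
        simp only [inner_smul_right, smul_smul]
        congr 1; ext k; ring_nf } C fun x => by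
    have hC : 0 ≤ C := (abs_nonneg _).trans (hd 0)
    refine abs_le_of_sq_le_sq' ?_ (by positivity) |>.2
    -- Expand `‖Dx‖² = ⟪Dx, Dx⟫` by the series in one slot and the coefficient formula in the other.
    have h := (innerSL ℝ (∑' k, (d k * ⟪e k, x⟫_ℝ) • e k)).hasSum (he.summable_diag hd x).hasSum
    simp only [innerSL_apply_apply, inner_smul_right] at h
    simp only [LinearMap.coe_mk, AddHom.coe_mk]
    rw [← real_inner_self_eq_norm_sq, ← h.tsum_eq]
    calc _ = ∑' k, d k ^ 2 * ⟪e k, x⟫_ℝ ^ 2 := by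
          congr 1; ext k
          rw [real_inner_comm (e k), he.inner_tsum_diag hd]; ring
      _ ≤ ∑' k, C ^ 2 * ⟪e k, x⟫_ℝ ^ 2 := by
          have h2 : ∀ k, d k ^ 2 ≤ C ^ 2 := fun k => sq_le_sq' (abs_le.1 (hd k)).1 (abs_le.1 (hd k)).2
          refine Summable.tsum_le_tsum (fun k => mul_le_mul_of_nonneg_right (h2 k) (sq_nonneg _)) ?_
            ((he.summable_inner_sq x).mul_left _)
          exact he.summable_mul_inner_sq (C := C ^ 2)
            (fun k => by rw [abs_of_nonneg (sq_nonneg _)]; exact h2 k) x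
      _ ≤ (C * ‖x‖) ^ 2 := by
          rw [tsum_mul_left, mul_pow]
          gcongr
          exact he.tsum_inner_sq_le x

variable {e : ℕ → H} (he : Orthonormal ℝ e) {d : ℕ → ℝ} {C : ℝ} (hd : ∀ k, |d k| ≤ C)

theorem Orthonormal.inner_diagOp (x : H) (k : ℕ) :
    ⟪e k, he.diagOp d C hd x⟫_ℝ = d k * ⟪e k, x⟫_ℝ :=
  he.inner_tsum_diag hd x k

theorem Orthonormal.hasSum_diagOp (x : H) :
    HasSum (fun k => (d k * ⟪e k, x⟫_ℝ) • e k) (he.diagOp d C hd x) :=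
  (he.summable_diag hd x).hasSum

theorem Orthonormal.hasSum_inner_diagOp (x y : H) :
    HasSum (fun k => d k * ⟪e k, x⟫_ℝ * ⟪e k, y⟫_ℝ) ⟪he.diagOp d C hd x, y⟫_ℝ := by
  have h := (innerSL ℝ y).hasSum (he.hasSum_diagOp hd x)
  simp only [innerSL_apply_apply, inner_smul_right] at h
  rw [real_inner_comm]
  simpa only [real_inner_comm y] using h

theorem Orthonormal.inner_diagOp_comm (x y : H) :
    ⟪he.diagOp d C hd x, y⟫_ℝ = ⟪x, he.diagOp d C hd y⟫_ℝ := by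
  rw [real_inner_comm (he.diagOp d C hd y) x]
  refine (he.hasSum_inner_diagOp hd x y).unique
    ((he.hasSum_inner_diagOp hd y x).congr_fun fun k => ?_)
  ring

/-- The orthogonal projection onto the closed span of `e`. -/
noncomputable def Orthonormal.spanProj : H →L[ℝ] H :=
  he.diagOp (fun _ => 1) 1 (by simp)

theorem Orthonormal.inner_spanProj (x : H) (k : ℕ) : ⟪e k, he.spanProj x⟫_ℝ = ⟪e k, x⟫_ℝ := by
  rw [spanProj, he.inner_diagOp, one_mul]

theorem Orthonormal.hasSum_spanProj (x : H) :
    HasSum (fun k => ⟪e k, x⟫_ℝ • e k) (he.spanProj x) := by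
  simpa [spanProj] using he.hasSum_diagOp (d := fun _ => 1) (C := 1) (by simp) x

theorem Orthonormal.hasSum_inner_spanProj (x y : H) :
    HasSum (fun k => ⟪e k, x⟫_ℝ * ⟪e k, y⟫_ℝ) ⟪he.spanProj x, y⟫_ℝ := by
  simpa [spanProj] using he.hasSum_inner_diagOp (d := fun _ => 1) (C := 1) (by simp) x y

theorem Orthonormal.spanProj_diagOp (x : H) :
    he.spanProj (he.diagOp d C hd x) = he.diagOp d C hd x := by
  have h := (he.hasSum_spanProj (he.diagOp d C hd x))
  simp only [he.inner_diagOp] at h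
  exact h.unique (he.hasSum_diagOp hd x)

theorem Orthonormal.hasSum_norm_sq_of_spanProj_eq {x : H} (hx : he.spanProj x = x) :
    HasSum (fun k => ⟪e k, x⟫_ℝ ^ 2) (‖x‖ ^ 2) := by
  have h := he.hasSum_inner_spanProj x x
  rw [hx, real_inner_self_eq_norm_sq] at h
  simpa only [sq] using h

/-- The part of `x` orthogonal to all `e k` is killed by `A`, so only the projection of `x` onto
their closed span contributes. -/
theorem Orthonormal.hasSum_inner_of_eigenvalues {e : ℕ → H} (he : Orthonormal ℝ e) {A : H →L[ℝ] H} {lam : ℕ → ℝ}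
    (hAe : ∀ k, A (e k) = lam k • e k) (hA0 : ∀ x, (∀ k, ⟪e k, x⟫_ℝ = 0) → A x = 0) (x : H) :
    HasSum (fun k => lam k * ⟪e k, x⟫_ℝ ^ 2) ⟪A x, x⟫_ℝ := by
  have h0 : A (x - he.spanProj x) = 0 :=
    hA0 _ fun k => by rw [inner_sub_right, he.inner_spanProj, sub_self]
  rw [map_sub, sub_eq_zero] at h0
  have h := (innerSL ℝ x).hasSum (A.hasSum (he.hasSum_spanProj x))
  simp only [innerSL_apply_apply, map_smul, hAe] at h
  rw [real_inner_comm, h0]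
  refine h.congr_fun fun k => ?_
  rw [real_inner_comm x]; ring

end DiagonalOperator

/-! ### The Gaussian measure in eigencoordinates. -/

section DiagonalGaussian

open ProbabilityTheory

/-- `μ` is a centered Gaussian measure whose covariance is diagonal along the orthonormal
sequence `e`, with positive summable variances `lam`. -/
structure IsDiagonalGaussian {H : Type*} [NormedAddCommGroup H] [InnerProductSpace ℝ H]
    [MeasurableSpace H] [BorelSpace H] (e : ℕ → H) (lam : ℕ → ℝ) (μ : Measure H) : Prop where
  isGaussian : IsGaussian μ
  orthonormal : Orthonormal ℝ e
  pos : ∀ k, 0 < lam k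
  summable : Summable lam
  mean : ∫ x, x ∂μ = 0
  cov : ∀ u, HasSum (fun k => lam k * ⟪e k, u⟫_ℝ ^ 2) (∫ z, ⟪u, z⟫_ℝ ^ 2 ∂μ)
  cov_basis : ∀ j k, ∫ z, ⟪e j, z⟫_ℝ * ⟪e k, z⟫_ℝ ∂μ = if j = k then lam k else 0

variable {H : Type*} [NormedAddCommGroup H] [InnerProductSpace ℝ H] [CompleteSpace H]
  [SecondCountableTopology H] [MeasurableSpace H] [BorelSpace H]

theorem IsCenteredGaussian.isDiagonalGaussian {A : H →L[ℝ] H} {μ : Measure H}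
    (hμ : IsCenteredGaussian μ A) {e : ℕ → H} {lam : ℕ → ℝ} (he : Orthonormal ℝ e)
    (hAe : ∀ k, A (e k) = lam k • e k) (hA0 : ∀ x, (∀ k, ⟪e k, x⟫_ℝ = 0) → A x = 0)
    (hpos : ∀ k, 0 < lam k) (hsum : Summable lam) : IsDiagonalGaussian e lam μ := by
  obtain ⟨hG, hm, hA⟩ := hμ
  have hinner := covarianceOperator_inner (IsGaussian.memLp_two_id (μ := μ))
  rw [hA] at hinner
  refine ⟨hG, he, hpos, hsum, hm, fun u => ?_, fun j k => ?_⟩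
  · have h := he.hasSum_inner_of_eigenvalues hAe hA0 u
    rw [hinner] at h
    simpa only [sq] using h
  · rw [← hinner, hAe, inner_smul_left, orthonormal_iff_ite.1 he]
    by_cases h : j = k <;> simp [h]

namespace IsDiagonalGaussian

variable {e : ℕ → H} {lam : ℕ → ℝ} {μ : Measure H} (h : IsDiagonalGaussian e lam μ)
include h

theorem integral_inner (u : H) : ∫ z, ⟪u, z⟫_ℝ ∂μ = 0 := by
  have := h.isGaussian
  have h1 := IsGaussian.integral_dual (μ := μ) (innerSL ℝ u)
  simpa [h.mean] using h1

theorem memLp_inner (u : H) : MemLp (fun z => ⟪u, z⟫_ℝ) 2 μ := by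
  have := h.isGaussian
  exact IsGaussian.memLp_dual μ (innerSL ℝ u) 2 (by simp)

theorem variance_inner (u : H) : Var[fun z => ⟪u, z⟫_ℝ; μ] = ∑' k, lam k * ⟪e k, u⟫_ℝ ^ 2 := by
  rw [variance_of_integral_eq_zero (h.memLp_inner u).aemeasurable (h.integral_inner u)]
  exact (h.cov u).tsum_eq.symm

theorem charFun_eq (u : H) :
    charFun μ u = Complex.exp ((-(∑' k, lam k * ⟪e k, u⟫_ℝ ^ 2) / 2 : ℝ) : ℂ) := by
  have := h.isGaussian
  rw [IsGaussian.charFun_eq, h.variance_inner, integral_complex_ofReal, h.integral_inner]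
  push_cast
  congr 1
  ring

/-- The component orthogonal to all `e k` has characteristic function one, so its law is the Dirac
mass at zero. Hence coordinate expansions hold almost everywhere even when the covariance has a
kernel. -/
theorem ae_spanProj_eq : ∀ᵐ x ∂μ, h.orthonormal.spanProj x = x := by
  have := h.isGaussian
  set P : H →L[ℝ] H := ContinuousLinearMap.id ℝ H - h.orthonormal.spanProj with hP
  have hPe : ∀ u k, ⟪e k, P u⟫_ℝ = 0 := fun u k => by
    simp [hP, inner_sub_right, h.orthonormal.inner_spanProj]
  have hadj : ∀ u x, ⟪P x, u⟫_ℝ = ⟪x, P u⟫_ℝ := fun u x => by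
    simp only [hP, sub_apply, ContinuousLinearMap.id_apply, inner_sub_left, inner_sub_right,
      Orthonormal.spanProj, Orthonormal.inner_diagOp_comm]
  have hmap : μ.map P = Measure.dirac 0 := by
    have := Measure.isProbabilityMeasure_map (μ := μ) P.continuous.aemeasurable
    refine Measure.ext_of_charFun ?_
    ext u
    have h1 : charFun (μ.map P) u = charFun μ (P u) := by
      rw [charFun_apply, charFun_apply, integral_map P.continuous.aemeasurable (by fun_prop)]
      simp only [hadj]
    rw [h1, h.charFun_eq, charFun_dirac]
    simp [hPe]
  have h2 : ∀ᵐ y ∂(μ.map P), y = 0 := by rw [hmap]; simp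
  filter_upwards [ae_of_ae_map P.continuous.aemeasurable h2] with x hx
  simp only [hP, sub_apply, ContinuousLinearMap.id_apply, sub_eq_zero] at hx
  exact hx.symm

theorem map_coord (k : ℕ) :
    μ.map (fun z => ⟪e k, z⟫_ℝ) = gaussianReal 0 (lam k).toNNReal := by
  have := h.isGaussian
  have hv : Var[fun z => ⟪e k, z⟫_ℝ; μ] = lam k := by
    rw [h.variance_inner, tsum_eq_single k fun j hj => by
      simp [h.orthonormal.inner_eq_zero hj]]
    simp [h.orthonormal.1 k]
  have h1 := IsGaussian.map_eq_gaussianReal (μ := μ) (innerSL ℝ (e k))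
  simp only [innerSL_apply_apply] at h1
  have h2 : (⇑(innerSL ℝ (e k)) : H → ℝ) = fun z => ⟪e k, z⟫_ℝ := by ext; simp
  rw [h2, hv, h.integral_inner] at h1
  exact h1

/-- Jointly Gaussian, uncorrelated variables are independent. -/
theorem iIndepFun_coord (n : ℕ) :
    iIndepFun (fun (i : Fin n) z => ⟪e i, z⟫_ℝ) μ := by
  have := h.isGaussian
  refine HasGaussianLaw.iIndepFun_of_covariance_eq_zero ?_ fun i j hij => ?_
  · exact (IsGaussian.hasGaussianLaw_id (μ := μ)).map_fun
      (ContinuousLinearMap.pi fun i : Fin n => innerSL ℝ (e i))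
  · rw [covariance_eq_sub (h.memLp_inner _) (h.memLp_inner _), h.integral_inner]
    simp only [Pi.mul_apply]
    rw [h.cov_basis, if_neg (by simpa [Fin.ext_iff] using hij)]
    simp

end IsDiagonalGaussian

/-- The tilt by `-b y²/2` changes the variance to `v/(1 + bv)`, and the logarithmic term normalizes
it. A complex `z` carries a real tilt and a Fourier variable at once. -/
theorem integral_cexp_quadratic_gaussianReal {v b : ℝ} (hv : 0 < v) (hb : 0 ≤ b) (z : ℂ) :
    ∫ y : ℝ, Complex.exp ((Real.log (1 + b * v) / 2 : ℝ) - (b / 2 : ℝ) * (y : ℂ) ^ 2 + z * y)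
      ∂(gaussianReal 0 v.toNNReal) = Complex.exp (v * z ^ 2 / (2 * (1 + b * v))) := by
  have hbv : 0 < 1 + b * v := by positivity
  rw [integral_gaussianReal_eq_integral_smul (by simpa using hv)]
  have hpi := Real.pi_pos
  have hs : √(1 + b * v) = Real.exp (Real.log (1 + b * v) / 2) := by
    rw [Real.exp_half, Real.exp_log hbv]
  have key : ∀ y : ℝ, gaussianPDFReal 0 v.toNNReal y •
      Complex.exp ((Real.log (1 + b * v) / 2 : ℝ) - (b / 2 : ℝ) * (y : ℂ) ^ 2 + z * y) =
      ((√(1 + b * v) * (√(2 * Real.pi * v))⁻¹ : ℝ) : ℂ) *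
      Complex.exp ((-((1 + b * v) / (2 * v)) : ℝ) * (y : ℂ) ^ 2 + z * y + 0) := fun y => by
    rw [gaussianPDFReal, Real.coe_toNNReal _ hv.le, Complex.real_smul, hs]
    push_cast
    rw [mul_comm (Complex.exp _) (_⁻¹), mul_assoc _ _ (Complex.exp _), mul_assoc _ _ (Complex.exp _),
      ← Complex.exp_add, ← Complex.exp_add]
    congr 2
    have : (v : ℂ) ≠ 0 := by exact_mod_cast hv.ne'
    field_simp
    ring
  simp only [key]
  rw [integral_const_mul, integral_cexp_quadratic (by
    rw [Complex.ofReal_re, neg_lt_zero]; positivity)]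
  have h1 : ((Real.pi : ℂ) / -((-((1 + b * v) / (2 * v)) : ℝ) : ℂ)) ^ (1 / 2 : ℂ) =
      ((√(2 * Real.pi * v) * (√(1 + b * v))⁻¹ : ℝ) : ℂ) := by
    rw [← Complex.ofReal_neg, neg_neg, ← Complex.ofReal_div,
      show (1 / 2 : ℂ) = ((1 / 2 : ℝ) : ℂ) by push_cast; rfl,
      ← Complex.ofReal_cpow (by positivity), ← Real.sqrt_eq_rpow, ← div_eq_mul_inv,
      ← Real.sqrt_div (by positivity)]
    congr 2
    field_simp
  rw [h1, ← mul_assoc, ← Complex.ofReal_mul]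
  have h2 : √(1 + b * v) * (√(2 * Real.pi * v))⁻¹ * (√(2 * Real.pi * v) * (√(1 + b * v))⁻¹) = 1 := by
    have := (Real.sqrt_pos.2 hbv).ne'
    have h3 : √(2 * Real.pi * v) ≠ 0 := (Real.sqrt_pos.2 (by positivity)).ne'
    field_simp
  rw [h2, Complex.ofReal_one, one_mul]
  congr 1
  have : (v : ℂ) ≠ 0 := by exact_mod_cast hv.ne'
  have h4 : (1 + b * v : ℂ) ≠ 0 := by exact_mod_cast hbv.ne'
  push_cast
  field_simp
  ring

end DiagonalGaussian

/-! ### Scalar identities for the shrinkage function. -/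

section SpectralShrinkage

variable {ε x : ℝ}

theorem spectralShrinkage_pos (hε : 0 < ε) (hx : 0 < x) : 0 < spectralShrinkage ε x := by
  unfold spectralShrinkage; positivity

/-- The quadratic equation behind the explicit formula; later arguments use it instead of the square
root. -/
theorem mul_one_sub_spectralShrinkage_sq (hε : 0 < ε) (hx : 0 < x) :
    x * (1 - spectralShrinkage ε x ^ 2) = ε * spectralShrinkage ε x := by
  unfold spectralShrinkage
  have h : √(4 * x ^ 2 + ε ^ 2) ^ 2 = 4 * x ^ 2 + ε ^ 2 := Real.sq_sqrt (by positivity)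
  have h2 : 0 < √(4 * x ^ 2 + ε ^ 2) + ε := by positivity
  generalize √(4 * x ^ 2 + ε ^ 2) = s at *
  field_simp
  linear_combination h

theorem spectralShrinkage_lt_one (hε : 0 < ε) (hx : 0 < x) : spectralShrinkage ε x < 1 := by
  have h1 := spectralShrinkage_pos hε hx
  have h2 := mul_one_sub_spectralShrinkage_sq hε hx
  by_contra! h
  have : x * (1 - spectralShrinkage ε x ^ 2) ≤ 0 := mul_nonpos_of_nonneg_of_nonpos hx.le (by nlinarith)
  have : 0 < ε * spectralShrinkage ε x := by positivity
  linarith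

/-- With `b = ρ/ε`, this turns the tilted variance `x/(1 + bx)` into `x(1 - ρ²)`. -/
theorem one_add_spectralShrinkage_div_mul (hε : 0 < ε) (hx : 0 < x) :
    (1 + spectralShrinkage ε x / ε * x) * (1 - spectralShrinkage ε x ^ 2) = 1 := by
  have h := mul_one_sub_spectralShrinkage_sq hε hx
  field_simp
  linear_combination spectralShrinkage ε x * h

theorem abs_spectralShrinkage_le_one (hε : 0 < ε) (hx : 0 < x) : |spectralShrinkage ε x| ≤ 1 := by
  rw [abs_of_pos (spectralShrinkage_pos hε hx)]
  exact (spectralShrinkage_lt_one hε hx).le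

end SpectralShrinkage

/-! ### The density of the entropic coupling and its conditional laws. -/

namespace IsDiagonalGaussian

open ProbabilityTheory

variable {H : Type*} [NormedAddCommGroup H] [InnerProductSpace ℝ H] [CompleteSpace H]
  [SecondCountableTopology H] [MeasurableSpace H] [BorelSpace H]
  {e : ℕ → H} {lam : ℕ → ℝ} {μ : Measure H} (h : IsDiagonalGaussian e lam μ) {ε : ℝ} (hε : 0 < ε)

/-- The spectral shrinkage of the covariance operator of `μ`. -/
noncomputable def shrinkOp : H →L[ℝ] H :=
  h.orthonormal.diagOp (fun k => spectralShrinkage ε (lam k)) 1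
    fun k => abs_spectralShrinkage_le_one hε (h.pos k)

/-- The logarithm of the density of the entropic optimal coupling with respect to `μ ⊗ μ`. -/
noncomputable def eotExponent (p : H × H) : ℝ :=
  (∑' k, Real.log (1 + spectralShrinkage ε (lam k) / ε * lam k) / 2)
    - (⟪h.shrinkOp hε p.1, p.1⟫_ℝ + ⟪h.shrinkOp hε p.2, p.2⟫_ℝ) / (2 * ε) + ⟪p.1, p.2⟫_ℝ / ε

/-- The entropic optimal coupling of `μ` with itself. -/
noncomputable def eotCoupling : Measure (H × H) :=
  (μ.prod μ).tilted (h.eotExponent hε)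

theorem continuous_eotExponent : Continuous (h.eotExponent hε) := by
  unfold eotExponent; fun_prop

include h

include hε in
theorem log_nonneg_of_shrinkage (k : ℕ) :
    0 ≤ Real.log (1 + spectralShrinkage ε (lam k) / ε * lam k) / 2 := by
  have h1 := spectralShrinkage_pos hε (h.pos k)
  have h2 := h.pos k
  have : 0 ≤ Real.log (1 + spectralShrinkage ε (lam k) / ε * lam k) :=
    Real.log_nonneg (by rw [le_add_iff_nonneg_right]; positivity)
  positivity

include hε in
-- The normalizing constant is finite: `log(1 + u) ≤ u` and `ρ < 1` bound the terms by `λ_k/(2ε)`.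
theorem summable_log_shrinkage :
    Summable fun k => Real.log (1 + spectralShrinkage ε (lam k) / ε * lam k) / 2 := by
  refine Summable.of_nonneg_of_le (h.log_nonneg_of_shrinkage hε) (fun k => ?_)
    (h.summable.mul_left (1 / (2 * ε)))
  have h1 := spectralShrinkage_pos hε (h.pos k)
  have h2 := h.pos k
  have h3 := Real.log_le_sub_one_of_pos (x := 1 + spectralShrinkage ε (lam k) / ε * lam k)
    (by positivity)
  have h4 : spectralShrinkage ε (lam k) / ε * lam k ≤ 1 / ε * lam k := by
    gcongr; exact (spectralShrinkage_lt_one hε h2).le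
  have h5 : 1 / (2 * ε) * lam k = 1 / ε * lam k / 2 := by field_simp
  rw [h5]
  linarith

/-- Fernique's theorem together with `a‖y‖ ≤ a²/(4C) + C‖y‖²`. -/
theorem integrable_exp_mul_norm (a : ℝ) : Integrable (fun y => Real.exp (a * ‖y‖)) μ := by
  have := h.isGaussian
  obtain ⟨C, hC, hint⟩ := IsGaussian.exists_integrable_exp_sq μ
  refine (hint.const_mul (Real.exp (a ^ 2 / (4 * C)))).mono' (by fun_prop) (ae_of_all _ fun y => ?_)
  rw [Real.norm_eq_abs, abs_of_pos (Real.exp_pos _), ← Real.exp_add]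
  gcongr
  have : a ^ 2 / (4 * C) + C * ‖y‖ ^ 2 - a * ‖y‖ = (a - 2 * C * ‖y‖) ^ 2 / (4 * C) := by
    field_simp; ring
  have : 0 ≤ (a - 2 * C * ‖y‖) ^ 2 / (4 * C) := by positivity
  linarith

omit h in
theorem sum_inner_mul_inner_le (he : Orthonormal ℝ e) (x y : H) (n : ℕ) :
    ∑ k ∈ Finset.range n, ⟪e k, x⟫_ℝ * ⟪e k, y⟫_ℝ ≤ ‖x‖ * ‖y‖ := by
  have hb : ∀ z : H, √(∑ k ∈ Finset.range n, ⟪e k, z⟫_ℝ ^ 2) ≤ ‖z‖ := fun z => by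
    rw [Real.sqrt_le_left (norm_nonneg _)]
    simpa using he.sum_inner_products_le (x := z) (s := Finset.range n)
  exact (Real.sum_mul_le_sqrt_mul_sqrt _ _ _).trans
    (mul_le_mul (hb x) (hb y) (Real.sqrt_nonneg _) (norm_nonneg _))

theorem integral_cexp_sum_quadratic {b : ℕ → ℝ} (hb : ∀ k, 0 ≤ b k) (z : ℕ → ℂ) (n : ℕ) :
    ∫ y, Complex.exp (∑ k ∈ Finset.range n, ((Real.log (1 + b k * lam k) / 2 : ℝ) -
      (b k / 2 : ℝ) * (⟪e k, y⟫_ℝ : ℂ) ^ 2 + z k * ⟪e k, y⟫_ℝ)) ∂μ =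
    Complex.exp (∑ k ∈ Finset.range n, lam k * z k ^ 2 / (2 * (1 + b k * lam k))) := by
  have := h.isGaussian
  rw [← Fin.sum_univ_eq_sum_range (fun k => (lam k : ℂ) * z k ^ 2 / (2 * (1 + b k * lam k))) n,
    Complex.exp_sum]
  simp only [← integral_cexp_quadratic_gaussianReal (h.pos _) (hb _)]
  have hind := (h.iIndepFun_coord n).integral_fun_prod_comp
    (f := fun (k : Fin n) (y : ℝ) => Complex.exp ((Real.log (1 + b k * lam k) / 2 : ℝ) -
      (b k / 2 : ℝ) * (y : ℂ) ^ 2 + z k * y))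
    (fun i => by fun_prop) (fun i => by fun_prop)
  calc _ = ∫ y, ∏ k : Fin n, Complex.exp ((Real.log (1 + b k * lam k) / 2 : ℝ) -
      (b k / 2 : ℝ) * (⟪e k, y⟫_ℝ : ℂ) ^ 2 + z k * ⟪e k, y⟫_ℝ) ∂μ := by
        congr 1; ext y
        rw [← Complex.exp_sum, ← Fin.sum_univ_eq_sum_range (fun k => ((Real.log (1 + b k * lam k) / 2 : ℝ) -
      (b k / 2 : ℝ) * (⟪e k, y⟫_ℝ : ℂ) ^ 2 + z k * ⟪e k, y⟫_ℝ)) n]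
    _ = _ := by
        rw [hind]
        refine Finset.prod_congr rfl fun k _ => ?_
        rw [← h.map_coord k, integral_map (by fun_prop) (by fun_prop)]

/-- The conditional characteristic function of `y` given `x`. Independence makes it exact on
finitely many coordinates, and dominated convergence removes the truncation. -/
theorem integral_cexp_eotExponent (x v : H) :
    ∫ y, Complex.exp (h.eotExponent hε (x, y) + ⟪v, y⟫_ℝ * Complex.I) ∂μ =
      Complex.exp (⟪h.shrinkOp hε x, v⟫_ℝ * Complex.I -
        (∑' k, lam k * (1 - spectralShrinkage ε (lam k) ^ 2) * ⟪e k, v⟫_ℝ ^ 2 : ℝ) / 2) := by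
  have he := h.orthonormal
  set ρ : ℕ → ℝ := fun k => spectralShrinkage ε (lam k) with hρ
  have hρpos : ∀ k, 0 < ρ k := fun k => spectralShrinkage_pos hε (h.pos k)
  have hb : ∀ k, 0 ≤ ρ k / ε := fun k => div_nonneg (hρpos k).le hε.le
  -- The real part is the tilt coming from `⟪x, y⟫/ε`, the imaginary part the Fourier variable.
  set z : ℕ → ℂ := fun k => (⟪e k, x⟫_ℝ / ε : ℝ) + ⟪e k, v⟫_ℝ * Complex.I with hz
  have hεC : (ε : ℂ) ≠ 0 := by exact_mod_cast hε.ne'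
  -- limit of the right-hand sides
  have hR : Tendsto (fun n => Complex.exp (∑ k ∈ Finset.range n,
      lam k * z k ^ 2 / (2 * (1 + ((ρ k / ε : ℝ) : ℂ) * lam k)))) atTop
      (𝓝 (Complex.exp ((⟪h.shrinkOp hε x, x⟫_ℝ / (2 * ε) : ℝ) + ⟪h.shrinkOp hε x, v⟫_ℝ * Complex.I -
        (∑' k, lam k * (1 - ρ k ^ 2) * ⟪e k, v⟫_ℝ ^ 2 : ℝ) / 2))) := by
    refine (Complex.continuous_exp.tendsto _).comp (HasSum.tendsto_sum_nat ?_)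
    have h1 := (Complex.hasSum_ofReal.2
      ((he.hasSum_inner_diagOp (d := ρ) (C := 1)
        (fun k => abs_spectralShrinkage_le_one hε (h.pos k)) x x).div_const (2 * ε)))
    have h2 := (Complex.hasSum_ofReal.2
      (he.hasSum_inner_diagOp (d := ρ) (C := 1)
        (fun k => abs_spectralShrinkage_le_one hε (h.pos k)) x v)).mul_right Complex.I
    have h3 : Summable fun k => lam k * (1 - ρ k ^ 2) * ⟪e k, v⟫_ℝ ^ 2 := by
      refine he.summable_mul_inner_sq (C := ε) (fun k => ?_) v
      rw [mul_one_sub_spectralShrinkage_sq hε (h.pos k), abs_of_pos (mul_pos hε (hρpos k))]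
      exact mul_le_of_le_one_right hε.le (spectralShrinkage_lt_one hε (h.pos k)).le
    have h4 := (Complex.hasSum_ofReal.2 h3.hasSum).div_const 2
    refine ((h1.add h2).sub h4).congr_fun fun k => ?_
    have h5 := one_add_spectralShrinkage_div_mul hε (h.pos k)
    have h6 := mul_one_sub_spectralShrinkage_sq hε (h.pos k)
    have h7 : (1 + (ρ k / ε : ℝ) * (lam k : ℂ)) * (1 - (ρ k : ℂ) ^ 2) = 1 := by exact_mod_cast h5
    have h8 : (lam k : ℂ) * (1 - (ρ k : ℂ) ^ 2) = ε * ρ k := by exact_mod_cast h6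
    have h10 : (lam k : ℂ) * z k ^ 2 / (2 * (1 + (ρ k / ε : ℝ) * (lam k : ℂ))) =
        ε * ρ k * z k ^ 2 / 2 := by
      rw [div_eq_mul_inv, mul_inv, inv_eq_of_mul_eq_one_right h7, ← h8]
      ring
    rw [h10, h6]
    simp only [hz]
    push_cast
    field_simp
    ring_nf
    rw [Complex.I_sq]
    ring
  -- limit of the left-hand sides, by dominated convergence
  have hL : Tendsto (fun n => ∫ y, Complex.exp (∑ k ∈ Finset.range n,
      ((Real.log (1 + ρ k / ε * lam k) / 2 : ℝ) -
      (ρ k / ε / 2 : ℝ) * (⟪e k, y⟫_ℝ : ℂ) ^ 2 + z k * ⟪e k, y⟫_ℝ)) ∂μ) atTop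
      (𝓝 (∫ y, Complex.exp ((⟪h.shrinkOp hε x, x⟫_ℝ / (2 * ε) : ℝ) +
        (h.eotExponent hε (x, y) + ⟪v, y⟫_ℝ * Complex.I)) ∂μ)) := by
    refine tendsto_integral_of_dominated_convergence
      (fun y => Real.exp (∑' k, Real.log (1 + ρ k / ε * lam k) / 2) * Real.exp (‖x‖ / ε * ‖y‖))
      (fun n => by fun_prop) ((h.integrable_exp_mul_norm _).const_mul _)
      (fun n => ae_of_all _ fun y => ?_) ?_
    · rw [Complex.norm_exp, ← Real.exp_add, Complex.re_sum]
      gcongr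
      -- Only real parts enter the modulus. Dropping the nonpositive quadratic term leaves a bound
      -- that Cauchy-Schwarz and Bessel make uniform in `n`.
      have hre : ∀ k, ((Real.log (1 + ρ k / ε * lam k) / 2 : ℝ) -
          (ρ k / ε / 2 : ℝ) * (⟪e k, y⟫_ℝ : ℂ) ^ 2 + z k * ⟪e k, y⟫_ℝ).re ≤
          Real.log (1 + ρ k / ε * lam k) / 2 + (⟪e k, x⟫_ℝ * ⟪e k, y⟫_ℝ) / ε := fun k => by
        simp only [hz, ← Complex.ofReal_pow, Complex.add_re, Complex.sub_re, Complex.mul_re,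
          Complex.ofReal_re, Complex.ofReal_im, Complex.add_im, Complex.mul_im, Complex.I_re,
          Complex.I_im]
        have : 0 ≤ ρ k / ε / 2 * ⟪e k, y⟫_ℝ ^ 2 := mul_nonneg (half_pos (div_pos (hρpos k) hε)).le (sq_nonneg _)
        have h2 : ⟪e k, x⟫_ℝ * ⟪e k, y⟫_ℝ / ε = ⟪e k, x⟫_ℝ / ε * ⟪e k, y⟫_ℝ := by ring
        rw [h2]
        linarith
      refine (Finset.sum_le_sum fun k _ => hre k).trans ?_
      rw [Finset.sum_add_distrib, ← Finset.sum_div _ _ ε]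
      refine add_le_add ((h.summable_log_shrinkage hε).sum_le_tsum _
        fun k _ => h.log_nonneg_of_shrinkage hε k) ?_
      rw [div_mul_eq_mul_div]
      gcongr
      exact sum_inner_mul_inner_le he x y n
    -- `⟪x, y⟫` is the sum of its coordinate products because `y` lies almost surely in the closed
    -- span of `e`.
    · filter_upwards [h.ae_spanProj_eq] with y hy
      refine (Complex.continuous_exp.tendsto _).comp (HasSum.tendsto_sum_nat ?_)
      have h1 := Complex.hasSum_ofReal.2
        (show Summable fun k => Real.log (1 + ρ k / ε * lam k) / 2 from
          h.summable_log_shrinkage hε).hasSum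
      have h2 := Complex.hasSum_ofReal.2 ((he.hasSum_inner_diagOp (d := ρ) (C := 1)
        (fun k => abs_spectralShrinkage_le_one hε (h.pos k)) y y).div_const (2 * ε))
      have h3 := Complex.hasSum_ofReal.2 ((he.hasSum_inner_spanProj y x).div_const ε)
      have h4 := (Complex.hasSum_ofReal.2 (he.hasSum_inner_spanProj y v)).mul_right Complex.I
      rw [hy] at h3 h4
      have hval : ((⟪h.shrinkOp hε x, x⟫_ℝ / (2 * ε) : ℝ) : ℂ) +
          (h.eotExponent hε (x, y) + ⟪v, y⟫_ℝ * Complex.I) =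
          ((∑' k, Real.log (1 + ρ k / ε * lam k) / 2 : ℝ) - (⟪h.shrinkOp hε y, y⟫_ℝ / (2 * ε) : ℝ)) +
          ((⟪y, x⟫_ℝ / ε : ℝ) + ⟪y, v⟫_ℝ * Complex.I) := by
        rw [real_inner_comm y v]
        simp only [eotExponent]
        rw [real_inner_comm y x]
        push_cast
        field_simp
        ring
      rw [hval]
      refine ((h1.sub h2).add (h3.add h4)).congr_fun fun k => ?_
      simp only [hz]
      push_cast
      field_simp
  have hn : ∀ n, _ := fun n => h.integral_cexp_sum_quadratic hb z n
  have hlim := tendsto_nhds_unique (hL.congr hn) hR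
  -- The truncations omit the term `-⟪Rx, x⟫/(2ε)`, which does not depend on `y`; both limits
  -- therefore carry its inverse exponential, which cancels.
  simp only [Complex.exp_add, integral_const_mul] at hlim
  rw [add_sub_assoc, Complex.exp_add] at hlim
  have := mul_left_cancel₀ (Complex.exp_ne_zero _) hlim
  simpa only [Complex.exp_add] using this

end IsDiagonalGaussian

/-! ### Integrals and almost-sure statements along marginals. -/

section Coupling

variable {X Y : Type*} [MeasurableSpace X] [MeasurableSpace Y] {π : Measure (X × Y)}
  {μ : Measure X} {ν : Measure Y}

theorem IsCoupling.isProbabilityMeasure [IsProbabilityMeasure μ] (hπ : IsCoupling π μ ν) :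
    IsProbabilityMeasure π := by
  have h : IsProbabilityMeasure (π.map Prod.fst) := by rw [hπ.1]; infer_instance
  exact Measure.isProbabilityMeasure_of_map Prod.fst

theorem IsCoupling.integrable_comp_fst (hπ : IsCoupling π μ ν) {g : X → ℝ}
    (hg : Integrable g μ) : Integrable (fun p => g p.1) π := by
  rw [← hπ.1] at hg
  exact hg.comp_measurable measurable_fst

theorem IsCoupling.integrable_comp_snd (hπ : IsCoupling π μ ν) {g : Y → ℝ}
    (hg : Integrable g ν) : Integrable (fun p => g p.2) π := by
  rw [← hπ.2] at hg
  exact hg.comp_measurable measurable_snd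

theorem IsCoupling.integral_comp_fst (hπ : IsCoupling π μ ν) {g : X → ℝ}
    (hg : AEStronglyMeasurable g μ) : ∫ p, g p.1 ∂π = ∫ x, g x ∂μ := by
  rw [← hπ.1] at hg ⊢
  exact (integral_map measurable_fst.aemeasurable hg).symm

theorem IsCoupling.integral_comp_snd (hπ : IsCoupling π μ ν) {g : Y → ℝ}
    (hg : AEStronglyMeasurable g ν) : ∫ p, g p.2 ∂π = ∫ x, g x ∂ν := by
  rw [← hπ.2] at hg ⊢
  exact (integral_map measurable_snd.aemeasurable hg).symm

theorem IsCoupling.ae_comp_fst (hπ : IsCoupling π μ ν) {P : X → Prop} (hP : ∀ᵐ x ∂μ, P x) :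
    ∀ᵐ p ∂π, P p.1 := by
  rw [← hπ.1] at hP
  exact ae_of_ae_map measurable_fst.aemeasurable hP

theorem IsCoupling.ae_comp_snd (hπ : IsCoupling π μ ν) {P : Y → Prop} (hP : ∀ᵐ x ∂ν, P x) :
    ∀ᵐ p ∂π, P p.2 := by
  rw [← hπ.2] at hP
  exact ae_of_ae_map measurable_snd.aemeasurable hP

end Coupling

/-! ### Marginals, optimality and uniqueness of the entropic coupling. -/

namespace IsDiagonalGaussian

open ProbabilityTheory InformationTheory

variable {H : Type*} [NormedAddCommGroup H] [InnerProductSpace ℝ H] [CompleteSpace H]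
  [SecondCountableTopology H] [MeasurableSpace H] [BorelSpace H]
  {e : ℕ → H} {lam : ℕ → ℝ} {μ : Measure H} (h : IsDiagonalGaussian e lam μ) {ε : ℝ} (hε : 0 < ε)

theorem integral_exp_eotExponent_left (x : H) :
    ∫ y, Real.exp (h.eotExponent hε (x, y)) ∂μ = 1 := by
  have h1 := h.integral_cexp_eotExponent hε x 0
  simp only [inner_zero_left, inner_zero_right, Complex.ofReal_zero, zero_mul, add_zero] at h1
  have h2 : (∑' k, lam k * (1 - spectralShrinkage ε (lam k) ^ 2) * (0 : ℝ) ^ 2) = 0 := by simp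
  rw [h2, Complex.ofReal_zero, zero_div, sub_zero, Complex.exp_zero] at h1
  simp only [← Complex.ofReal_exp] at h1
  rw [integral_complex_ofReal] at h1
  exact_mod_cast h1

theorem integrable_exp_eotExponent :
    Integrable (fun p => Real.exp (h.eotExponent hε p)) (μ.prod μ) := by
  have := h.isGaussian
  have hc := h.continuous_eotExponent hε
  rw [integrable_prod_iff (by fun_prop)]
  refine ⟨ae_of_all _ fun x => ?_, ?_⟩
  -- A non-integrable function has integral zero by convention, but this integral is one.
  · by_contra hn
    have := h.integral_exp_eotExponent_left hε x
    rw [integral_undef hn] at this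
    exact zero_ne_one this
  · simp only [Real.norm_eq_abs, Real.abs_exp, h.integral_exp_eotExponent_left]
    exact integrable_const _

theorem integral_exp_eotExponent : ∫ p, Real.exp (h.eotExponent hε p) ∂(μ.prod μ) = 1 := by
  have := h.isGaussian
  rw [integral_prod _ (h.integrable_exp_eotExponent hε)]
  simp [h.integral_exp_eotExponent_left]

theorem isProbabilityMeasure_eotCoupling : IsProbabilityMeasure (h.eotCoupling hε) := by
  have := h.isGaussian
  exact isProbabilityMeasure_tilted (h.integrable_exp_eotExponent hε)

include h in
theorem summable_mul_inner_mul_inner {d : ℕ → ℝ} (hd : ∀ k, |d k| ≤ 1) (u v : H) :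
    Summable fun k => d k * lam k * (⟪e k, u⟫_ℝ * ⟪e k, v⟫_ℝ) := by
  refine (h.summable.mul_left (‖u‖ * ‖v‖)).of_norm_bounded fun k => ?_
  have hn : ∀ w : H, ‖⟪e k, w⟫_ℝ‖ ≤ ‖w‖ := fun w =>
    (norm_inner_le_norm _ _).trans (by rw [h.orthonormal.1 k, one_mul])
  rw [norm_mul, norm_mul, norm_mul, Real.norm_eq_abs (d k), Real.norm_eq_abs (lam k),
    abs_of_pos (h.pos k)]
  calc |d k| * lam k * (‖⟪e k, u⟫_ℝ‖ * ‖⟪e k, v⟫_ℝ‖) ≤ 1 * lam k * (‖u‖ * ‖v‖) := by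
        have := (h.pos k).le
        gcongr
        · exact hd k
        · exact hn u
        · exact hn v
    _ = _ := by ring

/-- Integrate the conditional characteristic function over `x`; coordinatewise `(u + ρv)² + (1 -
ρ²)v² = u² + v² + 2ρuv`. -/
theorem integral_cexp_inner_eotCoupling (u v : H) :
    ∫ p, Complex.exp ((⟪u, p.1⟫_ℝ + ⟪v, p.2⟫_ℝ : ℝ) * Complex.I) ∂(h.eotCoupling hε) =
      Complex.exp ((-(∑' k, lam k * (⟪e k, u⟫_ℝ ^ 2 + ⟪e k, v⟫_ℝ ^ 2 +
        2 * spectralShrinkage ε (lam k) * (⟪e k, u⟫_ℝ * ⟪e k, v⟫_ℝ))) / 2 : ℝ) : ℂ) := by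
  have := h.isGaussian
  have hc := h.continuous_eotExponent hε
  have hint : Integrable (fun p : H × H => Complex.exp (h.eotExponent hε p) *
      Complex.exp ((⟪u, p.1⟫_ℝ + ⟪v, p.2⟫_ℝ : ℝ) * Complex.I)) (μ.prod μ) := by
    refine (h.integrable_exp_eotExponent hε).mono' (by fun_prop) (ae_of_all _ fun p => ?_)
    rw [norm_mul, Complex.norm_exp_ofReal_mul_I, mul_one, Complex.norm_exp_ofReal]
  rw [eotCoupling, integral_tilted]
  simp only [h.integral_exp_eotExponent, div_one, Complex.real_smul, Complex.ofReal_exp]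
  rw [integral_prod _ hint]
  set S := (∑' k, lam k * (1 - spectralShrinkage ε (lam k) ^ 2) * ⟪e k, v⟫_ℝ ^ 2) with hS
  have hx : ∀ x : H, ∫ y, Complex.exp (h.eotExponent hε (x, y)) *
      Complex.exp ((⟪u, x⟫_ℝ + ⟪v, y⟫_ℝ : ℝ) * Complex.I) ∂μ =
      Complex.exp (⟪x, u + h.shrinkOp hε v⟫_ℝ * Complex.I) * Complex.exp (-S / 2) := fun x => by
    have h1 := h.integral_cexp_eotExponent hε x v
    rw [← hS] at h1
    have h2 : ∀ y : H, Complex.exp (h.eotExponent hε (x, y)) *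
        Complex.exp ((⟪u, x⟫_ℝ + ⟪v, y⟫_ℝ : ℝ) * Complex.I) =
        Complex.exp (⟪u, x⟫_ℝ * Complex.I) *
          Complex.exp (h.eotExponent hε (x, y) + ⟪v, y⟫_ℝ * Complex.I) := fun y => by
      rw [← Complex.exp_add, ← Complex.exp_add]
      push_cast
      congr 1; ring
    simp only [h2]
    rw [integral_const_mul, h1, ← Complex.exp_add, ← Complex.exp_add, inner_add_right,
      shrinkOp, ← Orthonormal.inner_diagOp_comm, real_inner_comm u x]
    push_cast
    congr 1; ring
  simp only [hx]
  rw [integral_mul_const, ← charFun_apply, h.charFun_eq, ← Complex.exp_add]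
  congr 1
  rw [show -(S : ℂ) / 2 = ((-S / 2 : ℝ) : ℂ) by push_cast; ring, ← Complex.ofReal_add]
  congr 1
  have hρ : ∀ k, |spectralShrinkage ε (lam k)| ≤ 1 :=
    fun k => abs_spectralShrinkage_le_one hε (h.pos k)
  have s1 : Summable fun k => lam k * ⟪e k, u + h.shrinkOp hε v⟫_ℝ ^ 2 := by
    simpa [sq] using h.summable_mul_inner_mul_inner (d := fun _ => 1) (by simp) (u + h.shrinkOp hε v)
      (u + h.shrinkOp hε v)
  have s2 : Summable fun k => lam k * (1 - spectralShrinkage ε (lam k) ^ 2) * ⟪e k, v⟫_ℝ ^ 2 := by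
    refine (h.summable_mul_inner_mul_inner (d := fun k => 1 - spectralShrinkage ε (lam k) ^ 2)
      (fun k => ?_) v v).congr fun k => by ring
    have := (sq_le_one_iff_abs_le_one _).2 (hρ k)
    rw [abs_of_nonneg (by linarith)]
    linarith [sq_nonneg (spectralShrinkage ε (lam k))]
  rw [← add_div, ← neg_add, hS, ← s1.tsum_add s2]
  congr 3
  ext k
  rw [inner_add_right, shrinkOp, Orthonormal.inner_diagOp]
  ring

theorem eotCoupling_isCoupling : IsCoupling (h.eotCoupling hε) μ μ := by
  have := h.isGaussian
  have := h.isProbabilityMeasure_eotCoupling hε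
  constructor
  · refine Measure.ext_of_charFun ?_
    ext u
    have h1 := h.integral_cexp_inner_eotCoupling hε u 0
    rw [charFun_apply, integral_map (by fun_prop) (by fun_prop), h.charFun_eq]
    simp only [inner_zero_right] at h1
    simpa [fun x => real_inner_comm x u] using h1
  · refine Measure.ext_of_charFun ?_
    ext u
    have h1 := h.integral_cexp_inner_eotCoupling hε 0 u
    rw [charFun_apply, integral_map (by fun_prop) (by fun_prop), h.charFun_eq]
    simp only [inner_zero_right] at h1
    simpa [fun x => real_inner_comm x u] using h1

include h in
theorem integrable_norm_sq : Integrable (fun x => ‖x‖ ^ 2) μ := by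
  have := h.isGaussian
  simpa using (IsGaussian.memLp_two_id (μ := μ)).integrable_norm_pow (p := 2) (by norm_num)

include h in
theorem integrable_norm_sub_sq {π : Measure (H × H)} (hπ : IsCoupling π μ μ) :
    Integrable (fun p : H × H => ‖p.1 - p.2‖ ^ 2) π := by
  refine ((hπ.integrable_comp_fst (h.integrable_norm_sq.const_mul 2)).add
    (hπ.integrable_comp_snd (h.integrable_norm_sq.const_mul 2))).mono' (by fun_prop)
    (ae_of_all _ fun p => ?_)
  rw [Real.norm_eq_abs, abs_of_nonneg (sq_nonneg _), Pi.add_apply]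
  nlinarith [norm_sub_le p.1 p.2, sq_nonneg (‖p.1‖ - ‖p.2‖), norm_nonneg (p.1 - p.2)]

include h in
theorem transportCost_eq {π : Measure (H × H)} (hπ : IsCoupling π μ μ) :
    transportCost π = ENNReal.ofReal (∫ p, ‖p.1 - p.2‖ ^ 2 ∂π) := by
  rw [ofReal_integral_eq_lintegral_ofReal (h.integrable_norm_sub_sq hπ)
    (ae_of_all _ fun p => sq_nonneg _), transportCost]
  congr 1; ext p
  rw [edist_eq_enorm_sub, ← ofReal_norm, ENNReal.ofReal_pow (norm_nonneg _)]

/-- The part of the entropic cost which is the same for all couplings. -/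
noncomputable def eotPotential (x : H) : ℝ := ‖x‖ ^ 2 - ⟪h.shrinkOp hε x, x⟫_ℝ

theorem integrable_inner_shrinkOp : Integrable (fun x => ⟪h.shrinkOp hε x, x⟫_ℝ) μ := by
  refine (h.integrable_norm_sq.const_mul ‖h.shrinkOp hε‖).mono' (by fun_prop)
    (ae_of_all _ fun x => ?_)
  refine (norm_inner_le_norm _ _).trans ?_
  rw [sq, ← mul_assoc]
  gcongr
  exact (h.shrinkOp hε).le_opNorm x

theorem integrable_eotPotential : Integrable (h.eotPotential hε) μ :=
  h.integrable_norm_sq.sub (h.integrable_inner_shrinkOp hε)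

theorem eotPotential_nonneg (x : H) : 0 ≤ h.eotPotential hε x := by
  rw [eotPotential, sub_nonneg]
  have h1 : HasSum _ ⟪h.shrinkOp hε x, x⟫_ℝ := h.orthonormal.hasSum_inner_diagOp _ x x
  rw [← h1.tsum_eq]
  refine (Summable.tsum_le_tsum (fun k => ?_) h1.summable
    (h.orthonormal.summable_inner_sq x)).trans (h.orthonormal.tsum_inner_sq_le x)
  rw [mul_assoc, ← sq]
  exact mul_le_of_le_one_left (sq_nonneg _) (spectralShrinkage_lt_one hε (h.pos k)).le

/-- The cross terms in `⟪x, y⟫` cancel. What remains separates, so its integral depends on the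
marginals only. -/
theorem norm_sub_sq_add_eotExponent (p : H × H) :
    ‖p.1 - p.2‖ ^ 2 + 2 * ε * h.eotExponent hε p =
      2 * ε * (∑' k, Real.log (1 + spectralShrinkage ε (lam k) / ε * lam k) / 2) +
        (h.eotPotential hε p.1 + h.eotPotential hε p.2) := by
  rw [eotExponent, eotPotential, eotPotential, norm_sub_sq_real]
  field_simp
  ring

/-- The minimal entropic cost of a self-coupling of `μ`. -/
noncomputable def eotValue : ℝ :=
  2 * ε * (∑' k, Real.log (1 + spectralShrinkage ε (lam k) / ε * lam k) / 2) +
    2 * ∫ x, h.eotPotential hε x ∂μ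

theorem eotValue_nonneg : 0 ≤ h.eotValue hε := by
  have h1 : 0 ≤ ∑' k, Real.log (1 + spectralShrinkage ε (lam k) / ε * lam k) / 2 :=
    tsum_nonneg (h.log_nonneg_of_shrinkage hε)
  have h2 : 0 ≤ ∫ x, h.eotPotential hε x ∂μ := integral_nonneg (h.eotPotential_nonneg hε)
  unfold eotValue
  positivity

theorem integrable_eotExponent {π : Measure (H × H)} (hπ : IsCoupling π μ μ) :
    Integrable (h.eotExponent hε) π := by
  have := h.isGaussian
  have := hπ.isProbabilityMeasure
  have h1 : h.eotExponent hε = fun p => (2 * ε)⁻¹ *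
      ((2 * ε * (∑' k, Real.log (1 + spectralShrinkage ε (lam k) / ε * lam k) / 2) +
        (h.eotPotential hε p.1 + h.eotPotential hε p.2)) - ‖p.1 - p.2‖ ^ 2) := by
    ext p
    rw [← h.norm_sub_sq_add_eotExponent hε p]
    field_simp
    ring
  rw [h1]
  exact (((integrable_const _).add ((hπ.integrable_comp_fst (h.integrable_eotPotential hε)).add
    (hπ.integrable_comp_snd (h.integrable_eotPotential hε)))).sub
      (h.integrable_norm_sub_sq hπ)).const_mul _

theorem integral_norm_sub_sq_add {π : Measure (H × H)} (hπ : IsCoupling π μ μ) :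
    ∫ p, ‖p.1 - p.2‖ ^ 2 ∂π + 2 * ε * ∫ p, h.eotExponent hε p ∂π = h.eotValue hε := by
  have := h.isGaussian
  have := hπ.isProbabilityMeasure
  have hi := h.integrable_eotPotential hε
  rw [← integral_const_mul, ← integral_add (h.integrable_norm_sub_sq hπ)
    ((h.integrable_eotExponent hε hπ).const_mul _)]
  simp only [h.norm_sub_sq_add_eotExponent]
  have h1 := (hπ.integrable_comp_fst hi).fun_add (hπ.integrable_comp_snd hi)
  rw [integral_add (integrable_const _) h1, integral_add (hπ.integrable_comp_fst hi) (hπ.integrable_comp_snd hi),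
    hπ.integral_comp_fst hi.1, hπ.integral_comp_snd hi.1, eotValue]
  simp only [integral_const, probReal_univ, smul_eq_mul, one_mul]
  ring

/-- The chain rule `KL(π ‖ μ ⊗ μ) = KL(π ‖ π_ε) + ∫ L dπ`, where the `L` term and the transport cost
add up to a constant. -/
theorem entropicCost_eq {π : Measure (H × H)} (hπ : IsCoupling π μ μ) (hac : π ≪ μ.prod μ)
    (hint : Integrable (llr π (μ.prod μ)) π) :
    entropicCost ε μ μ π =
      ENNReal.ofReal (2 * ε * (klDiv π (h.eotCoupling hε)).toReal + h.eotValue hε) := by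
  have := h.isGaussian
  have := hπ.isProbabilityMeasure
  have := h.isProbabilityMeasure_eotCoupling hε
  have hL := h.integrable_eotExponent hε hπ
  have hexp := h.integrable_exp_eotExponent hε
  have hac' : π ≪ h.eotCoupling hε := hac.trans (absolutelyContinuous_tilted hexp)
  rw [entropicCost, h.transportCost_eq hπ, klDiv_of_ac_of_integrable hac hint,
    toReal_klDiv_of_measure_eq hac' (by simp), eotCoupling,
    integral_llr_tilted_right hac hL hexp hint, h.integral_exp_eotExponent, Real.log_one, add_zero,
    ← h.integral_norm_sub_sq_add hε hπ]
  have hkl := integral_llr_add_sub_measure_univ_nonneg hac hint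
  simp only [probReal_univ, add_sub_cancel_right] at hkl ⊢
  rw [← ENNReal.ofReal_mul (by positivity), ← ENNReal.ofReal_add
    (integral_nonneg fun _ => sq_nonneg _) (by positivity)]
  congr 1
  ring

theorem entropicCost_eotCoupling :
    entropicCost ε μ μ (h.eotCoupling hε) = ENNReal.ofReal (h.eotValue hε) := by
  have := h.isGaussian
  have := h.isProbabilityMeasure_eotCoupling hε
  have hexp := h.integrable_exp_eotExponent hε
  have hac : h.eotCoupling hε ≪ μ.prod μ := tilted_absolutelyContinuous _ _
  rw [h.entropicCost_eq hε (h.eotCoupling_isCoupling hε) hac, klDiv_self]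
  · simp
  · refine (h.integrable_eotExponent hε (h.eotCoupling_isCoupling hε)).congr ?_
    filter_upwards [hac.ae_le (log_rnDeriv_tilted_left_self hexp)] with p hp
    rw [llr, eotCoupling, hp, h.integral_exp_eotExponent, Real.log_one, sub_zero]

theorem eotCoupling_isEOTCoupling : IsEOTCoupling ε μ μ (h.eotCoupling hε) := by
  refine ⟨h.eotCoupling_isCoupling hε, fun π hπ => ?_⟩
  rw [h.entropicCost_eotCoupling hε]
  by_cases hkl : π ≪ μ.prod μ ∧ Integrable (llr π (μ.prod μ)) π
  · rw [h.entropicCost_eq hε hπ hkl.1 hkl.2]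
    exact ENNReal.ofReal_le_ofReal (le_add_of_nonneg_left (by positivity))
  · rw [entropicCost, klDiv_eq_top_iff.2 fun h1 h2 => hkl ⟨h1, h2⟩,
      ENNReal.mul_top (by simpa using hε)]
    simp

theorem eq_eotCoupling {π : Measure (H × H)} (hπ : IsEOTCoupling ε μ μ π) :
    π = h.eotCoupling hε := by
  have := h.isGaussian
  have := hπ.1.isProbabilityMeasure
  have := h.isProbabilityMeasure_eotCoupling hε
  have hle := hπ.2 _ (h.eotCoupling_isCoupling hε)
  rw [h.entropicCost_eotCoupling hε] at hle
  by_cases hkl : π ≪ μ.prod μ ∧ Integrable (llr π (μ.prod μ)) π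
  · rw [h.entropicCost_eq hε hπ.1 hkl.1 hkl.2,
      ENNReal.ofReal_le_ofReal_iff (h.eotValue_nonneg hε)] at hle
    have h0 : (klDiv π (h.eotCoupling hε)).toReal = 0 :=
      le_antisymm (by nlinarith) ENNReal.toReal_nonneg
    rw [← klDiv_eq_zero_iff]
    -- `toReal` also vanishes at `⊤`, so finiteness of the divergence has to be shown separately.
    refine ((ENNReal.toReal_eq_zero_iff _).1 h0).resolve_right (klDiv_ne_top ?_ ?_)
    · exact hkl.1.trans (absolutelyContinuous_tilted (h.integrable_exp_eotExponent hε))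
    · exact integrable_llr_tilted_right hkl.1 (h.integrable_eotExponent hε hπ.1) hkl.2
        (h.integrable_exp_eotExponent hε)
  · rw [entropicCost, klDiv_eq_top_iff.2 fun h1 h2 => hkl ⟨h1, h2⟩,
      ENNReal.mul_top (by simpa using hε)] at hle
    simp at hle

end IsDiagonalGaussian

/-! ### Unregularized transport of a measure to itself. -/

section OptimalTransport

variable {X : Type*} [EMetricSpace X] [SecondCountableTopology X] [MeasurableSpace X]
  [BorelSpace X] {μ : Measure X}

theorem diag_isCoupling : IsCoupling (μ.map fun x => (x, x)) μ μ := by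
  constructor
  · rw [Measure.map_map measurable_fst (by fun_prop)]; exact Measure.map_id
  · rw [Measure.map_map measurable_snd (by fun_prop)]; exact Measure.map_id

theorem transportCost_diag : transportCost (μ.map fun x => (x, x)) = 0 := by
  rw [transportCost, lintegral_map (by fun_prop) (by fun_prop)]
  simp

theorem diag_isOTCoupling : IsOTCoupling μ μ (μ.map fun x => (x, x)) :=
  ⟨diag_isCoupling, fun _ _ => by simp [transportCost_diag]⟩

/-- The minimum is zero, and zero cost forces the two coordinates to agree almost everywhere. -/
theorem IsOTCoupling.eq_diag {π : Measure (X × X)} (hπ : IsOTCoupling μ μ π) :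
    π = μ.map fun x => (x, x) := by
  have h0 : transportCost π = 0 := by
    simpa [transportCost_diag] using hπ.2 _ diag_isCoupling
  rw [transportCost, lintegral_eq_zero_iff (by fun_prop)] at h0
  conv_rhs => rw [← hπ.1.1]
  rw [Measure.map_map (by fun_prop) measurable_fst]
  conv_lhs => rw [← Measure.map_id (μ := π)]
  refine Measure.map_congr ?_
  filter_upwards [h0] with p hp
  have : p.1 = p.2 := by simpa using hp
  simp [Prod.ext_iff, this]

end OptimalTransport

/-- Dual potentials can be negative; passing to the positive part lets them be compared with an
extended nonnegative cost. -/
theorem ofReal_integral_le_lintegral_of_ae_le {Ω : Type*} [MeasurableSpace Ω] {m : Measure Ω}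
    {g : Ω → ℝ} {G : Ω → ℝ≥0∞} (hg : Integrable g m) (hle : ∀ᵐ q ∂m, ENNReal.ofReal (g q) ≤ G q) :
    ENNReal.ofReal (∫ q, g q ∂m) ≤ ∫⁻ q, G q ∂m := by
  calc ENNReal.ofReal (∫ q, g q ∂m) ≤ ENNReal.ofReal (∫ q, max (g q) 0 ∂m) :=
        ENNReal.ofReal_le_ofReal (integral_mono hg hg.pos_part fun q => le_max_left _ _)
    _ = ∫⁻ q, ENNReal.ofReal (max (g q) 0) ∂m :=
        ofReal_integral_eq_lintegral_ofReal hg.pos_part (ae_of_all _ fun q => le_max_right _ _)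
    _ ≤ ∫⁻ q, G q ∂m := lintegral_mono_ae <| by
        filter_upwards [hle] with q hq
        rwa [ENNReal.ofReal_max, ENNReal.ofReal_zero, max_eq_left zero_le]

/-! ### The Wasserstein distance from the entropic coupling to the diagonal. -/

namespace IsDiagonalGaussian

open ProbabilityTheory

variable {H : Type*} [NormedAddCommGroup H] [InnerProductSpace ℝ H] [CompleteSpace H]
  [SecondCountableTopology H] [MeasurableSpace H] [BorelSpace H]
  {e : ℕ → H} {lam : ℕ → ℝ} {μ : Measure H} (h : IsDiagonalGaussian e lam μ) {ε : ℝ} (hε : 0 < ε)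

include h in
theorem integrable_coord_sq (k : ℕ) : Integrable (fun x => ⟪e k, x⟫_ℝ ^ 2) μ :=
  (h.memLp_inner (e k)).integrable_sq

include h in
theorem integral_coord_sq (k : ℕ) : ∫ x, ⟪e k, x⟫_ℝ ^ 2 ∂μ = lam k := by
  simpa [sq] using h.cov_basis k k

theorem integrable_coord_add_sq (k : ℕ) :
    Integrable (fun p : H × H => ⟪e k, p.1 + p.2⟫_ℝ ^ 2) (h.eotCoupling hε) := by
  have hπ := h.eotCoupling_isCoupling hε
  refine ((hπ.integrable_comp_fst ((h.integrable_coord_sq k).const_mul 2)).add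
    (hπ.integrable_comp_snd ((h.integrable_coord_sq k).const_mul 2))).mono' (by fun_prop)
    (ae_of_all _ fun p => ?_)
  rw [Real.norm_eq_abs, abs_of_nonneg (sq_nonneg _), Pi.add_apply, inner_add_right]
  nlinarith [sq_nonneg (⟪e k, p.1⟫_ℝ - ⟪e k, p.2⟫_ℝ)]

theorem map_coord_add_eotCoupling (k : ℕ) :
    (h.eotCoupling hε).map (fun p => ⟪e k, p.1 + p.2⟫_ℝ) =
      gaussianReal 0 (2 * lam k * (1 + spectralShrinkage ε (lam k))).toNNReal := by
  have := h.isProbabilityMeasure_eotCoupling hε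
  have hmeas : Measurable fun p : H × H => ⟪e k, p.1 + p.2⟫_ℝ := by fun_prop
  have := Measure.isProbabilityMeasure_map (μ := h.eotCoupling hε) hmeas.aemeasurable
  have hv : 0 ≤ 2 * lam k * (1 + spectralShrinkage ε (lam k)) := by
    have := h.pos k
    have := spectralShrinkage_pos hε (h.pos k)
    positivity
  refine Measure.ext_of_charFun ?_
  ext t
  have h1 := h.integral_cexp_inner_eotCoupling hε (t • e k) (t • e k)
  rw [tsum_eq_single k fun j hj => by
    simp [inner_smul_right, h.orthonormal.inner_eq_zero hj]] at h1
  rw [charFun_gaussianReal, Real.coe_toNNReal _ hv, charFun_apply,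
    integral_map hmeas.aemeasurable (by fun_prop)]
  convert h1 using 1
  · congr 1; ext p
    simp [inner_smul_left, inner_add_right]
    ring_nf
  · have hk : ⟪e k, t • e k⟫_ℝ = t := by simp [inner_smul_right, h.orthonormal.1 k]
    rw [hk]
    push_cast
    congr 1; ring

theorem integral_coord_add_sq (k : ℕ) :
    ∫ p, ⟪e k, p.1 + p.2⟫_ℝ ^ 2 ∂(h.eotCoupling hε) =
      2 * lam k * (1 + spectralShrinkage ε (lam k)) := by
  have hv : 0 ≤ 2 * lam k * (1 + spectralShrinkage ε (lam k)) := by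
    have := h.pos k
    have := spectralShrinkage_pos hε (h.pos k)
    positivity
  have h1 := variance_fun_id_gaussianReal (μ := 0)
    (v := (2 * lam k * (1 + spectralShrinkage ε (lam k))).toNNReal)
  rw [variance_of_integral_eq_zero (by fun_prop) (by simp), Real.coe_toNNReal _ hv,
    ← h.map_coord_add_eotCoupling hε k, integral_map (by fun_prop) (by fun_prop)] at h1
  exact h1

/-- The ratio `2 σ(X + Y) / (2 σ(X))` of standard deviations of a coordinate. -/
noncomputable def devRatio (ε : ℝ) (lam : ℕ → ℝ) (k : ℕ) : ℝ :=
  √(2 * (1 + spectralShrinkage ε (lam k)))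

include h hε in
theorem devRatio_sq (k : ℕ) : devRatio ε lam k ^ 2 = 2 * (1 + spectralShrinkage ε (lam k)) :=
  Real.sq_sqrt (by have := spectralShrinkage_pos hε (h.pos k); positivity)

include h hε in
theorem one_lt_devRatio (k : ℕ) : 1 < devRatio ε lam k := by
  rw [devRatio, Real.lt_sqrt zero_le_one]
  linarith [spectralShrinkage_pos hε (h.pos k)]

include h hε in
theorem devRatio_lt_two (k : ℕ) : devRatio ε lam k < 2 := by
  rw [devRatio, Real.sqrt_lt' zero_lt_two]
  linarith [spectralShrinkage_lt_one hε (h.pos k)]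

include h in
theorem perturbation_eq (k : ℕ) : perturbation ε (lam k) = 2 - devRatio ε lam k := by
  rw [perturbation, if_pos (h.pos k), devRatio]

include h hε in
theorem abs_inv_devRatio_le_one (k : ℕ) : |(devRatio ε lam k)⁻¹| ≤ 1 := by
  have h1 := h.one_lt_devRatio hε k
  rw [abs_of_pos (by positivity)]
  exact inv_le_one_of_one_le₀ h1.le

/-- The operator transporting the sum of the two marginals of the entropic coupling to `μ`. -/
noncomputable def sumTransport : H →L[ℝ] H :=
  h.orthonormal.diagOp (fun k => (devRatio ε lam k)⁻¹) 1 (h.abs_inv_devRatio_le_one hε)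

/-- The coordinate `x_k + y_k` has variance `2λ_k(1 + ρ_k) = a_k² λ_k`, so division by `a_k`
restores `λ_k`. -/
theorem map_sumTransport :
    (h.eotCoupling hε).map (fun p => h.sumTransport hε (p.1 + p.2)) = μ := by
  have := h.isGaussian
  have := h.isProbabilityMeasure_eotCoupling hε
  have hmeas : Measurable fun p : H × H => h.sumTransport hε (p.1 + p.2) := by fun_prop
  have := Measure.isProbabilityMeasure_map (μ := h.eotCoupling hε) hmeas.aemeasurable
  refine Measure.ext_of_charFun ?_
  ext u
  have h1 := h.integral_cexp_inner_eotCoupling hε (h.sumTransport hε u) (h.sumTransport hε u)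
  rw [charFun_apply, integral_map hmeas.aemeasurable (by fun_prop), h.charFun_eq]
  convert h1 using 1
  · congr 1; ext p
    rw [sumTransport, Orthonormal.inner_diagOp_comm, inner_add_left,
      real_inner_comm p.1, real_inner_comm p.2]
  · congr 5; ext k
    rw [sumTransport, Orthonormal.inner_diagOp]
    have h2 := h.devRatio_sq hε k
    have h3 : devRatio ε lam k ≠ 0 := (zero_lt_one.trans (h.one_lt_devRatio hε k)).ne'
    field_simp
    linear_combination lam k * ⟪e k, u⟫_ℝ ^ 2 * h2

include h hε in
theorem summable_perturbation : Summable fun k => 2 * lam k * perturbation ε (lam k) := by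
  refine Summable.of_nonneg_of_le (fun k => ?_) (fun k => ?_) (h.summable.mul_left 2)
  · rw [h.perturbation_eq]
    have := h.pos k
    have := h.devRatio_lt_two hε k
    exact mul_nonneg (by positivity) (by linarith)
  · rw [h.perturbation_eq]
    have := h.pos k
    have := h.one_lt_devRatio hε k
    exact mul_le_of_le_one_right (by positivity) (by linarith)

omit [CompleteSpace H] [SecondCountableTopology H] [MeasurableSpace H] [BorelSpace H] in
theorem edist_toLp_sq (p q : WithLp 2 (H × H)) :
    edist p q ^ 2 = ENNReal.ofReal (‖p.ofLp.1 - q.ofLp.1‖ ^ 2 + ‖p.ofLp.2 - q.ofLp.2‖ ^ 2) := by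
  rw [edist_eq_enorm_sub, ← ofReal_norm, ← ENNReal.ofReal_pow (norm_nonneg _),
    WithLp.prod_norm_sq_eq_of_L2]
  rfl

include h hε in
-- Weak Kantorovich duality on `n` coordinates, with Bessel's inequality discarding the others. Each
-- of the two potentials integrates to `(2 - a_k)λ_k`.
theorem sum_perturbation_le_transportCost {π : Measure (H × H)} (hπ : IsCoupling π μ μ)
    (hS : ∀ k, Integrable (fun p : H × H => ⟪e k, p.1 + p.2⟫_ℝ ^ 2) π)
    (hSI : ∀ k, ∫ p, ⟪e k, p.1 + p.2⟫_ℝ ^ 2 ∂π = 2 * lam k * (1 + spectralShrinkage ε (lam k)))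
    (n : ℕ) {Γ : Measure (WithLp 2 (H × H) × WithLp 2 (H × H))}
    (hΓ : IsCoupling Γ (π.map (WithLp.toLp 2))
      ((μ.map fun x => (x, x)).map (WithLp.toLp 2))) :
    ENNReal.ofReal (∑ k ∈ Finset.range n, 2 * lam k * perturbation ε (lam k)) ≤
      transportCost Γ := by
  set a : ℕ → ℝ := devRatio ε lam with ha
  have ha0 : ∀ k, 0 < a k := fun k => zero_lt_one.trans (h.one_lt_devRatio hε k)
  -- Chosen so that the cost to `(z, z)` exceeds `φ + ψ` by the square `(x + y - a z)²/a`, which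
  -- vanishes at `z = (x + y)/a`.
  set φ : ℕ → WithLp 2 (H × H) → ℝ := fun k p =>
    ⟪e k, p.ofLp.1⟫_ℝ ^ 2 + ⟪e k, p.ofLp.2⟫_ℝ ^ 2 - ⟪e k, p.ofLp.1 + p.ofLp.2⟫_ℝ ^ 2 / a k with hφ
  set ψ : ℕ → WithLp 2 (H × H) → ℝ := fun k q => (2 - a k) * ⟪e k, q.ofLp.1⟫_ℝ ^ 2 with hψ
  have hX : ∀ k, Integrable (fun p : H × H => ⟪e k, p.1⟫_ℝ ^ 2) π :=
    fun k => hπ.integrable_comp_fst (h.integrable_coord_sq k)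
  have hY : ∀ k, Integrable (fun p : H × H => ⟪e k, p.2⟫_ℝ ^ 2) π :=
    fun k => hπ.integrable_comp_snd (h.integrable_coord_sq k)
  have hφm : ∀ k, Measurable (φ k) := fun k => by
    have : Measurable fun p : H × H => ⟪e k, p.1⟫_ℝ ^ 2 + ⟪e k, p.2⟫_ℝ ^ 2 -
      ⟪e k, p.1 + p.2⟫_ℝ ^ 2 / a k := by fun_prop
    exact this.comp (WithLp.measurable_ofLp 2 _)
  have hψm : ∀ k, Measurable (ψ k) := fun k => by
    have : Measurable fun p : H × H => (2 - a k) * ⟪e k, p.1⟫_ℝ ^ 2 := by fun_prop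
    exact this.comp (WithLp.measurable_ofLp 2 _)
  have hφi : ∀ k, Integrable (φ k) (π.map (WithLp.toLp 2)) := fun k => by
    rw [integrable_map_measure (hφm k).aestronglyMeasurable (by fun_prop)]
    exact ((hX k).add (hY k)).sub ((hS k).div_const _)
  have hψi : ∀ k, Integrable (ψ k) ((μ.map fun x => (x, x)).map (WithLp.toLp 2)) := fun k => by
    rw [Measure.map_map (by fun_prop) (by fun_prop),
      integrable_map_measure (hψm k).aestronglyMeasurable (by fun_prop)]
    exact (h.integrable_coord_sq k).const_mul _
  have hφI : ∀ k, ∫ p, φ k p ∂(π.map (WithLp.toLp 2)) =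
      2 * lam k - a k * lam k := fun k => by
    rw [integral_map (by fun_prop) (hφm k).aestronglyMeasurable]
    simp only [hφ]
    have h1 := (hX k).fun_add (hY k)
    rw [integral_sub h1 ((hS k).div_const _), integral_add (hX k) (hY k),
      hπ.integral_comp_fst (h.integrable_coord_sq k).1,
      hπ.integral_comp_snd (h.integrable_coord_sq k).1, h.integral_coord_sq, integral_div,
      hSI]
    have h2 : a k ^ 2 = _ := h.devRatio_sq hε k
    have h3 := (ha0 k).ne'
    field_simp
    linear_combination lam k * h2
  have hψI : ∀ k, ∫ q, ψ k q ∂((μ.map fun x => (x, x)).map (WithLp.toLp 2)) =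
      (2 - a k) * lam k := fun k => by
    rw [Measure.map_map (by fun_prop) (by fun_prop),
      integral_map (by fun_prop) (hψm k).aestronglyMeasurable]
    simp only [hψ, Function.comp_apply]
    rw [integral_const_mul, h.integral_coord_sq]
  have hint : ∀ k, Integrable (fun r : WithLp 2 (H × H) × WithLp 2 (H × H) => φ k r.1 + ψ k r.2) Γ :=
    fun k => (hΓ.integrable_comp_fst (hφi k)).add (hΓ.integrable_comp_snd (hψi k))
  have hval : ∑ k ∈ Finset.range n, 2 * lam k * perturbation ε (lam k) =
      ∫ r, ∑ k ∈ Finset.range n, (φ k r.1 + ψ k r.2) ∂Γ := by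
    rw [integral_finsetSum _ fun k _ => hint k]
    refine Finset.sum_congr rfl fun k _ => ?_
    rw [integral_add (hΓ.integrable_comp_fst (hφi k)) (hΓ.integrable_comp_snd (hψi k)),
      hΓ.integral_comp_fst (hφi k).1, hΓ.integral_comp_snd (hψi k).1, hφI, hψI, h.perturbation_eq]
    ring
  rw [hval, transportCost]
  refine ofReal_integral_le_lintegral_of_ae_le (integrable_finsetSum _ fun k _ => hint k) ?_
  have hdiag : ∀ᵐ q ∂((μ.map fun x => (x, x)).map (WithLp.toLp 2)), q.ofLp.1 = q.ofLp.2 := by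
    rw [Measure.map_map (by fun_prop) (by fun_prop)]
    refine (ae_map_iff (by fun_prop) ?_).2 (ae_of_all _ fun x => rfl)
    exact (WithLp.measurable_ofLp 2 (H × H)) (measurableSet_eq_fun measurable_fst measurable_snd)
  filter_upwards [hΓ.ae_comp_snd hdiag] with r hr
  rw [edist_toLp_sq]
  refine ENNReal.ofReal_le_ofReal ?_
  have hb : ∀ z : H, ∑ k ∈ Finset.range n, ⟪e k, z⟫_ℝ ^ 2 ≤ ‖z‖ ^ 2 := fun z => by
    simpa using h.orthonormal.sum_inner_products_le (x := z) (s := Finset.range n)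
  refine le_trans ?_ (add_le_add (hb _) (hb _))
  rw [← Finset.sum_add_distrib]
  refine Finset.sum_le_sum fun k _ => ?_
  simp only [hφ, hψ, ← hr, inner_sub_right, inner_add_right]
  generalize ⟪e k, r.1.ofLp.1⟫_ℝ = x
  generalize ⟪e k, r.1.ofLp.2⟫_ℝ = y
  generalize ⟪e k, r.2.ofLp.1⟫_ℝ = z
  have h3 := ha0 k
  have h4 : (x - z) ^ 2 + (y - z) ^ 2 - (x ^ 2 + y ^ 2 - (x + y) ^ 2 / a k + (2 - a k) * z ^ 2) =
      (x + y - a k * z) ^ 2 / a k := by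
    field_simp; ring
  have h5 : 0 ≤ (x + y - a k * z) ^ 2 / a k := by positivity
  linarith

include h in
-- The plan induced by `p ↦ (T p, T p)`, with `T p` equal to `(x_k + y_k)/a_k` in coordinates, is
-- where the duality inequality is tight.
theorem exists_transportCost_eq {π : Measure (H × H)} (hπ : IsCoupling π μ μ)
    (hS : ∀ k, Integrable (fun p : H × H => ⟪e k, p.1 + p.2⟫_ℝ ^ 2) π)
    (hSI : ∀ k, ∫ p, ⟪e k, p.1 + p.2⟫_ℝ ^ 2 ∂π = 2 * lam k * (1 + spectralShrinkage ε (lam k)))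
    (hTπ : π.map (fun p => h.sumTransport hε (p.1 + p.2)) = μ) : ∃ Γ : Measure (WithLp 2 (H × H) × WithLp 2 (H × H)),
    IsCoupling Γ (π.map (WithLp.toLp 2))
      ((μ.map fun x => (x, x)).map (WithLp.toLp 2)) ∧
    transportCost Γ = ENNReal.ofReal (∑' k, 2 * lam k * perturbation ε (lam k)) := by
  obtain ⟨T, hT⟩ : ∃ T : H × H → H, T = fun p => h.sumTransport hε (p.1 + p.2) := ⟨_, rfl⟩
  rw [← hT] at hTπ
  have hTm : Measurable T := by rw [hT]; fun_prop
  have hm1 : Measurable fun p : H × H => WithLp.toLp 2 p := WithLp.measurable_toLp 2 _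
  have hm2 : Measurable fun p : H × H => WithLp.toLp 2 (T p, T p) :=
    hm1.comp (hTm.prodMk hTm)
  have hm : Measurable fun p : H × H => (WithLp.toLp 2 p, WithLp.toLp 2 (T p, T p)) :=
    hm1.prodMk hm2
  refine ⟨π.map fun p => (WithLp.toLp 2 p, WithLp.toLp 2 (T p, T p)),
    ⟨?_, ?_⟩, ?_⟩
  · rw [Measure.map_map measurable_fst hm]; rfl
  · rw [Measure.map_map measurable_snd hm]
    conv_rhs => rw [← hTπ]
    rw [Measure.map_map (by fun_prop) hTm, Measure.map_map hm1 (by fun_prop)]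
    rfl
  · rw [transportCost, lintegral_map (by fun_prop) hm]
    simp only [edist_toLp_sq]
    set a : ℕ → ℝ := devRatio ε lam with ha
    have ha0 : ∀ k, 0 < a k := fun k => zero_lt_one.trans (h.one_lt_devRatio hε k)
    set φ : ℕ → H × H → ℝ := fun k p =>
      ⟪e k, p.1 - T p⟫_ℝ ^ 2 + ⟪e k, p.2 - T p⟫_ℝ ^ 2 with hφ
    have hφ0 : ∀ k p, 0 ≤ φ k p := fun k p => by positivity
    have hφ' : ∀ k, φ k = fun p => ⟪e k, p.1⟫_ℝ ^ 2 + ⟪e k, p.2⟫_ℝ ^ 2 +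
        (2 / a k ^ 2 - 2 / a k) * ⟪e k, p.1 + p.2⟫_ℝ ^ 2 := fun k => by
      ext p
      simp only [hφ, hT, inner_sub_right, sumTransport, Orthonormal.inner_diagOp, ← ha]
      rw [inner_add_right]
      have := (ha0 k).ne'
      field_simp
      ring
    have hX : ∀ k, Integrable (fun p : H × H => ⟪e k, p.1⟫_ℝ ^ 2) π :=
      fun k => hπ.integrable_comp_fst (h.integrable_coord_sq k)
    have hY : ∀ k, Integrable (fun p : H × H => ⟪e k, p.2⟫_ℝ ^ 2) π :=
      fun k => hπ.integrable_comp_snd (h.integrable_coord_sq k)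
    have hφi : ∀ k, Integrable (φ k) π := fun k => by
      rw [hφ']
      exact ((hX k).add (hY k)).add ((hS k).const_mul _)
    have hφI : ∀ k, ∫ p, φ k p ∂π = 2 * lam k * perturbation ε (lam k) :=
        fun k => by
      simp only [hφ']
      have h1 := (hX k).fun_add (hY k)
      have h2 : a k ^ 2 = _ := h.devRatio_sq hε k
      have h3 := (ha0 k).ne'
      rw [integral_add h1 ((hS k).const_mul _), integral_add (hX k) (hY k),
        hπ.integral_comp_fst (h.integrable_coord_sq k).1,
        hπ.integral_comp_snd (h.integrable_coord_sq k).1, h.integral_coord_sq, integral_const_mul,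
        hSI, h.perturbation_eq, ← ha, mul_assoc 2 (lam k), mul_left_comm 2 (lam k), ← h2]
      field_simp
      ring
    have hTs : ∀ p, h.orthonormal.spanProj (T p) = T p := fun p => by
      simp only [hT, sumTransport, Orthonormal.spanProj_diagOp]
    -- Both differences lie in the closed span of `e` almost surely, so Parseval applies with
    -- equality; Tonelli then exchanges sum and integral.
    calc _ = ∫⁻ p, ∑' k, ENNReal.ofReal (φ k p) ∂π := by
          refine lintegral_congr_ae ?_
          filter_upwards [hπ.ae_comp_fst h.ae_spanProj_eq, hπ.ae_comp_snd h.ae_spanProj_eq]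
            with p hp1 hp2
          have hs := (h.orthonormal.hasSum_norm_sq_of_spanProj_eq (x := p.1 - T p)
            (by rw [map_sub, hp1, hTs])).add
            (h.orthonormal.hasSum_norm_sq_of_spanProj_eq (x := p.2 - T p)
            (by rw [map_sub, hp2, hTs]))
          rw [← hs.tsum_eq]
          exact ENNReal.ofReal_tsum_of_nonneg (fun k => hφ0 k p) hs.summable
      _ = ∑' k, ENNReal.ofReal (2 * lam k * perturbation ε (lam k)) := by
          rw [lintegral_tsum fun k => (hφi k).1.aemeasurable.ennreal_ofReal]
          congr 1; ext k
          rw [← hφI, ofReal_integral_eq_lintegral_ofReal (hφi k) (ae_of_all _ (hφ0 k))]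
      _ = _ := (ENNReal.ofReal_tsum_of_nonneg (fun k => by
          rw [← hφI]; exact integral_nonneg (hφ0 k)) (h.summable_perturbation hε)).symm

theorem wasserstein2Prod_eotCoupling_diag :
    (wasserstein2Prod (h.eotCoupling hε) (μ.map fun x => (x, x))).toReal ^ 2 =
      ∑' k, 2 * lam k * perturbation ε (lam k) := by
  have hinf : ⨅ (Γ : Measure (WithLp 2 (H × H) × WithLp 2 (H × H)))
      (_ : IsCoupling Γ ((h.eotCoupling hε).map (WithLp.toLp 2))
        ((μ.map fun x => (x, x)).map (WithLp.toLp 2))), transportCost Γ =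
      ENNReal.ofReal (∑' k, 2 * lam k * perturbation ε (lam k)) := by
    refine le_antisymm ?_ (le_iInf₂ fun Γ hΓ => ?_)
    · obtain ⟨Γ, hΓ, hc⟩ := h.exists_transportCost_eq hε (h.eotCoupling_isCoupling hε)
        (h.integrable_coord_add_sq hε) (h.integral_coord_add_sq hε) (h.map_sumTransport hε)
      exact (iInf₂_le Γ hΓ).trans_eq hc
    · exact le_of_tendsto' (ENNReal.tendsto_ofReal
        (h.summable_perturbation hε).hasSum.tendsto_sum_nat)
        fun n => h.sum_perturbation_le_transportCost hε (h.eotCoupling_isCoupling hε)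
          (h.integrable_coord_add_sq hε) (h.integral_coord_add_sq hε) n hΓ
  have h0 : 0 ≤ ∑' k, 2 * lam k * perturbation ε (lam k) := tsum_nonneg fun k => by
    rw [h.perturbation_eq]
    have := h.pos k
    have := h.devRatio_lt_two hε k
    exact mul_nonneg (by positivity) (by linarith)
  rw [wasserstein2Prod, wasserstein2, hinf, ENNReal.ofReal_rpow_of_nonneg h0 (by norm_num),
    ENNReal.toReal_ofReal (by positivity), ← Real.sqrt_eq_rpow, Real.sq_sqrt h0]

end IsDiagonalGaussian

/-! ### Riemann sums of decreasing functions on the half-line. -/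

section RiemannSum

/-- Monotone comparison places the sum between the integral over `(h, ∞)` and that integral plus `M
h`; the missing piece over `(0, h]` is at most `M h` too. -/
theorem AntitoneOn.abs_tsum_mul_sub_integral_le {g : ℝ → ℝ} {M : ℝ} (hanti : AntitoneOn g (Ioi 0))
    (h0 : ∀ t, 0 < t → 0 ≤ g t) (hM : ∀ t, 0 < t → g t ≤ M) (hint : IntegrableOn g (Ioi 0))
    {h : ℝ} (hh : 0 < h) :
    |h * ∑' k : ℕ, g (h * (k + 1)) - ∫ t in Ioi 0, g t| ≤ M * h := by
  have hf : AntitoneOn (fun s => g (h * s)) (Ici 1) := fun s hs t ht hst =>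
    hanti (mul_pos hh (zero_lt_one.trans_le hs)) (mul_pos hh (zero_lt_one.trans_le ht))
      (by gcongr)
  have hIcc : ∀ n : ℕ, Icc (1 : ℝ) (1 + n) ⊆ Ici 1 := fun n => Icc_subset_Ici_self
  have hint' : IntegrableOn g (Ioi h) := hint.mono_set (Ioi_subset_Ioi hh.le)
  have hsplit : ∫ t in Ioi 0, g t = (∫ t in Ioc 0 h, g t) + ∫ t in Ioi h, g t := by
    rw [← Ioc_union_Ioi_eq_Ioi hh.le, setIntegral_union (Ioc_disjoint_Ioi le_rfl) measurableSet_Ioi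
      (hint.mono_set Ioc_subset_Ioi_self) hint']
  have hsmall0 : 0 ≤ ∫ t in Ioc 0 h, g t :=
    setIntegral_nonneg measurableSet_Ioc fun t ht => h0 t ht.1
  have hsmall : ∫ t in Ioc 0 h, g t ≤ M * h := by
    have := setIntegral_mono_on (hint.mono_set Ioc_subset_Ioi_self)
      (integrableOn_const (C := M) (by simp)) (measurableSet_Ioc (b := h)) fun t ht => hM t ht.1
    simpa [hh.le, mul_comm] using this
  have hscale : ∀ n : ℕ, h * ∫ s in (1 : ℝ)..(1 + n), g (h * s) = ∫ t in h..(h * (1 + n)), g t :=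
    fun n => by
      rw [← smul_eq_mul, intervalIntegral.smul_integral_comp_mul_left, mul_one]
  have hle : ∀ n : ℕ, ∫ t in h..(h * (1 + n)), g t ≤ ∫ t in Ioi h, g t := fun n => by
    rw [intervalIntegral.integral_of_le (by nlinarith [n.cast_nonneg (α := ℝ)])]
    exact setIntegral_mono_set hint' ((ae_restrict_iff' measurableSet_Ioi).2
      (ae_of_all _ fun t ht => h0 t (hh.trans ht))) Ioc_subset_Ioi_self.eventuallyLE
  have hpos : ∀ k : ℕ, 0 ≤ g (h * (k + 1)) := fun k => h0 _ (by positivity)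
  have hupper : ∀ n, h * ∑ k ∈ Finset.range n, g (h * (k + 1)) ≤ M * h + ∫ t in Ioi h, g t := by
    intro n
    -- Split off the sample at `h`: the comparison with the integral starting there controls only
    -- the later samples.
    have h1 : ∑ k ∈ Finset.range n, g (h * (k + 1)) ≤
        g h + ∑ k ∈ Finset.range n, g (h * (1 + (k + 1 : ℕ))) := by
      calc _ ≤ ∑ k ∈ Finset.range (n + 1), g (h * (k + 1)) :=
            Finset.sum_le_sum_of_subset_of_nonneg (Finset.range_mono n.le_succ)
              fun k _ _ => hpos k
        _ = _ := by
            rw [Finset.sum_range_succ']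
            simp only [Nat.cast_zero, zero_add, mul_one, add_comm]
    have h2 := (hf.mono (hIcc n)).sum_le_integral
    have h3 := (hscale n).trans_le (hle n)
    nlinarith [mul_le_mul_of_nonneg_left h1 hh.le, mul_le_mul_of_nonneg_left h2 hh.le, hM h hh]
  have hsum : Summable fun k : ℕ => g (h * (k + 1)) := by
    refine summable_of_sum_range_le (c := h⁻¹ * (M * h + ∫ t in Ioi h, g t)) hpos fun n => ?_
    rw [inv_mul_eq_div, le_div_iff₀' hh]
    exact hupper n
  have hT := hsum.hasSum.tendsto_sum_nat.const_mul h
  have hU := le_of_tendsto' hT hupper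
  have hlim : Tendsto (fun n : ℕ => ∫ t in h..(h * (1 + n)), g t) atTop
      (𝓝 (∫ t in Ioi h, g t)) := by
    refine intervalIntegral_tendsto_integral_Ioi h hint' ?_
    exact (tendsto_atTop_add_const_left _ 1 tendsto_natCast_atTop_atTop).const_mul_atTop hh
  have hL := le_of_tendsto_of_tendsto' hlim hT fun n => by
    rw [← hscale n]
    have := (hf.mono (hIcc n)).integral_le_sum
    simp only [add_comm (1 : ℝ)] at this ⊢
    gcongr
  rw [abs_le]
  constructor <;> linarith

theorem AntitoneOn.tendsto_mul_tsum {g : ℝ → ℝ} {M : ℝ} (hanti : AntitoneOn g (Ioi 0))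
    (h0 : ∀ t, 0 < t → 0 ≤ g t) (hM : ∀ t, 0 < t → g t ≤ M) (hint : IntegrableOn g (Ioi 0)) :
    Tendsto (fun h : ℝ => h * ∑' k : ℕ, g (h * (k + 1))) (𝓝[>] 0) (𝓝 (∫ t in Ioi 0, g t)) := by
  rw [tendsto_iff_dist_tendsto_zero]
  have hz : Tendsto (fun h : ℝ => M * h) (𝓝[>] 0) (𝓝 0) := by
    have : Tendsto (fun h : ℝ => M * h) (𝓝 0) (𝓝 (M * 0)) := (continuous_const_mul M).tendsto 0
    rw [mul_zero] at this
    exact this.mono_left nhdsWithin_le_nhds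
  refine squeeze_zero' (Eventually.of_forall fun _ => dist_nonneg) ?_ hz
  filter_upwards [self_mem_nhdsWithin] with h hh
  exact hanti.abs_tsum_mul_sub_integral_le h0 hM hint hh

end RiemannSum

/-! ### Scaling and monotonicity of the perturbation function, and the limit of the series. -/

section Perturbation

theorem spectralShrinkage_eq_one_div {ε x : ℝ} (hε : 0 < ε) :
    spectralShrinkage ε x = spectralShrinkage 1 (x / ε) := by
  have h : √(4 * x ^ 2 + ε ^ 2) = ε * √(4 * (x / ε) ^ 2 + 1 ^ 2) := by
    rw [← Real.sqrt_sq hε.le, ← Real.sqrt_mul (sq_nonneg _), Real.sqrt_sq hε.le]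
    congr 1
    field_simp
  have h2 : 0 < √(4 * (x / ε) ^ 2 + 1 ^ 2) + 1 := by positivity
  rw [spectralShrinkage, spectralShrinkage, h, div_eq_div_iff (by positivity) h2.ne']
  field_simp

theorem perturbation_eq_one_div {ε x : ℝ} (hε : 0 < ε) :
    perturbation ε x = perturbation 1 (x / ε) := by
  simp only [perturbation, spectralShrinkage_eq_one_div hε, div_pos_iff_of_pos_right hε]

/-- If `ρ(y) < ρ(x)`, then `ρ(x) = x(1 - ρ(x)²) ≤ y(1 - ρ(y)²) = ρ(y)`, a contradiction. -/
theorem spectralShrinkage_mono {x y : ℝ} (hx : 0 < x) (hxy : x ≤ y) :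
    spectralShrinkage 1 x ≤ spectralShrinkage 1 y := by
  have hy := hx.trans_le hxy
  have h1 := mul_one_sub_spectralShrinkage_sq one_pos hx
  have h2 := mul_one_sub_spectralShrinkage_sq one_pos hy
  have h3 := spectralShrinkage_pos one_pos hx
  have h4 := spectralShrinkage_pos one_pos hy
  have h5 := spectralShrinkage_lt_one one_pos hx
  by_contra! hlt
  have h6 : x * (1 - spectralShrinkage 1 x ^ 2) ≤ y * (1 - spectralShrinkage 1 x ^ 2) := by
    refine mul_le_mul_of_nonneg_right hxy ?_
    nlinarith
  have h7 : y * spectralShrinkage 1 y ^ 2 ≤ y * spectralShrinkage 1 x ^ 2 := by gcongr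
  linarith

/-- Substituting `ρ = s²/2 - 1` in the quadratic equation expresses `x` with a factor `2 - s` in the
denominator, which cancels against `δ_1(x) = 2 - s`. Bounds and monotonicity become statements about
a rational function of `s`. -/
theorem mul_perturbation_eq {x : ℝ} (hx : 0 < x) :
    ∃ s : ℝ, s = √(2 * (1 + spectralShrinkage 1 x)) ∧ 1 < s ∧ 2 < s ^ 2 ∧ s < 2 ∧
      x * perturbation 1 x = 2 * (s ^ 2 - 2) / (s ^ 2 * (s + 2)) := by
  have h0 := spectralShrinkage_pos one_pos hx
  have h1 := spectralShrinkage_lt_one one_pos hx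
  have h2 := mul_one_sub_spectralShrinkage_sq one_pos hx
  have h3 : √(2 * (1 + spectralShrinkage 1 x)) ^ 2 = 2 * (1 + spectralShrinkage 1 x) :=
    Real.sq_sqrt (by positivity)
  have h4 : 1 < √(2 * (1 + spectralShrinkage 1 x)) := by
    rw [Real.lt_sqrt zero_le_one]; linarith
  have h5 : √(2 * (1 + spectralShrinkage 1 x)) < 2 := by
    rw [Real.sqrt_lt' zero_lt_two]; linarith
  refine ⟨_, rfl, h4, by linarith, h5, ?_⟩
  rw [perturbation, if_pos hx]
  set s := √(2 * (1 + spectralShrinkage 1 x))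
  have h6 : spectralShrinkage 1 x = s ^ 2 / 2 - 1 := by linarith
  rw [h6] at h2
  rw [eq_div_iff (by positivity)]
  linear_combination 4 * h2

theorem mul_perturbation_pos {x : ℝ} (hx : 0 < x) : 0 < x * perturbation 1 x := by
  obtain ⟨s, -, h1, h2, h3, h4⟩ := mul_perturbation_eq hx
  rw [h4]
  have : 0 < s ^ 2 - 2 := by linarith
  positivity

theorem mul_perturbation_le {x : ℝ} (hx : 0 < x) : x * perturbation 1 x ≤ 1 / 4 := by
  obtain ⟨s, -, h1, h2, h3, h4⟩ := mul_perturbation_eq hx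
  rw [h4, div_le_div_iff₀ (by positivity) (by norm_num)]
  -- The bound `1/4` is the value at `s = 2`; the difference factors as `s³ - 6s² + 16 = (2 - s)(8 +
  -- 4s - s²)`.
  nlinarith [mul_nonneg (sub_nonneg.2 h3.le) (show 0 ≤ 8 + 4 * s - s ^ 2 by nlinarith)]

theorem mul_perturbation_mono {x y : ℝ} (hx : 0 < x) (hxy : x ≤ y) :
    x * perturbation 1 x ≤ y * perturbation 1 y := by
  obtain ⟨a, ha, a1, a2, a3, a4⟩ := mul_perturbation_eq hx
  obtain ⟨b, hb, b1, b2, b3, b4⟩ := mul_perturbation_eq (hx.trans_le hxy)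
  have hab : a ≤ b := by
    rw [ha, hb]
    exact Real.sqrt_le_sqrt (by linarith [spectralShrinkage_mono hx hxy])
  rw [a4, b4, div_le_div_iff₀ (by positivity) (by positivity)]
  -- The cofactor of `b - a` after cross-multiplication; it is nonnegative since `a²b² ≤ 4ab ≤ 2(a²
  -- + ab + b²)`.
  have h1 : 0 ≤ 2 * (b ^ 2 + a * b + a ^ 2) + 4 * (a + b) - a ^ 2 * b ^ 2 := by
    have hab0 : 0 < a * b := by positivity
    have hab4 : a * b ≤ 4 := by nlinarith
    nlinarith [sq_nonneg (a - b), mul_nonneg hab0.le (sub_nonneg.2 hab4)]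
  linarith [mul_nonneg (sub_nonneg.2 hab) h1]

theorem perturbation_le_one {x : ℝ} (hx : 0 < x) : perturbation 1 x ≤ 1 := by
  obtain ⟨s, hs, h1, -⟩ := mul_perturbation_eq hx
  rw [perturbation, if_pos hx, ← hs]
  linarith

theorem measurable_perturbation : Measurable (perturbation 1) := by
  unfold perturbation spectralShrinkage
  exact Measurable.ite measurableSet_Ioi (by fun_prop) measurable_const

variable {α : ℝ}

theorem antitoneOn_rpow_mul_perturbation (hα : 0 < α) :
    AntitoneOn (fun t : ℝ => t ^ (-α) * perturbation 1 (t ^ (-α))) (Ioi 0) := fun s hs t ht hst =>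
  mul_perturbation_mono (Real.rpow_pos_of_pos ht _)
    (Real.rpow_le_rpow_of_nonpos hs hst (by linarith))

/-- Near zero the integrand is at most `1/4`; at infinity `δ_1 ≤ 1` leaves `t^(-α)`, integrable as
`α > 1`. -/
theorem integrableOn_rpow_mul_perturbation (hα : 1 < α) :
    IntegrableOn (fun t : ℝ => t ^ (-α) * perturbation 1 (t ^ (-α))) (Ioi 0) := by
  have hm : Measurable fun t : ℝ => t ^ (-α) * perturbation 1 (t ^ (-α)) :=
    (measurable_id.pow_const _).mul (measurable_perturbation.comp (measurable_id.pow_const _))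
  rw [← Ioc_union_Ioi_eq_Ioi zero_le_one]
  refine IntegrableOn.union ?_ ?_
  · refine (integrableOn_const (C := (1 / 4 : ℝ)) (by simp)).mono' hm.aestronglyMeasurable ?_
    filter_upwards [ae_restrict_mem measurableSet_Ioc] with t ht
    have ht' := Real.rpow_pos_of_pos ht.1 (-α)
    rw [Real.norm_eq_abs, abs_of_pos (mul_perturbation_pos ht')]
    exact mul_perturbation_le ht'
  · refine (integrableOn_Ioi_rpow_of_lt (neg_lt_neg hα) one_pos).mono' hm.aestronglyMeasurable ?_
    filter_upwards [ae_restrict_mem measurableSet_Ioi] with t ht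
    have ht' := Real.rpow_pos_of_pos (one_pos.trans ht) (-α)
    rw [Real.norm_eq_abs, abs_of_pos (mul_perturbation_pos ht')]
    exact mul_le_of_le_one_right ht'.le (perturbation_le_one ht')

theorem integral_rpow_mul_perturbation_pos (hα : 1 < α) :
    0 < ∫ t in Ioi (0 : ℝ), t ^ (-α) * perturbation 1 (t ^ (-α)) := by
  have hpos : ∀ t ∈ Ioi (0 : ℝ), 0 < t ^ (-α) * perturbation 1 (t ^ (-α)) := fun t ht =>
    mul_perturbation_pos (Real.rpow_pos_of_pos ht _)
  rw [setIntegral_pos_iff_support_of_nonneg_ae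
    ((ae_restrict_iff' measurableSet_Ioi).2 (ae_of_all _ fun t ht => (hpos t ht).le))
    (integrableOn_rpow_mul_perturbation hα),
    inter_eq_right.2 (show Ioi (0 : ℝ) ⊆ Function.support _ from fun t ht => (hpos t ht).ne')]
  simp

theorem tendsto_tsum_perturbation {c : ℝ} (hc : 0 < c) (hα : 1 < α) :
    Tendsto (fun ε : ℝ => (∑' k : ℕ, 2 * (c * ((k : ℝ) + 1) ^ (-α)) *
        perturbation ε (c * ((k : ℝ) + 1) ^ (-α))) / ε ^ (1 - 1 / α)) (𝓝[>] 0)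
      (𝓝 (2 * c ^ (1 / α) * ∫ t in Ioi (0 : ℝ), t ^ (-α) * perturbation 1 (t ^ (-α)))) := by
  have hα0 : 0 < α := one_pos.trans hα
  have hpos : ∀ t : ℝ, 0 < t → 0 < t ^ (-α) * perturbation 1 (t ^ (-α)) := fun t ht =>
    mul_perturbation_pos (Real.rpow_pos_of_pos ht _)
  have hR := (antitoneOn_rpow_mul_perturbation hα0).tendsto_mul_tsum
    (fun t ht => (hpos t ht).le) (fun t ht => mul_perturbation_le (Real.rpow_pos_of_pos ht _))
    (integrableOn_rpow_mul_perturbation hα)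
  -- The mesh `h = (ε/c)^(1/α)` solves `(h(k+1))^(-α) = λ_k/ε`. Then `λ_k δ_ε(λ_k) = ε g(h(k+1))`,
  -- and `ε^(1/α) = c^(1/α) h` accounts for the constant in the limit.
  have hh : Tendsto (fun ε : ℝ => (ε / c) ^ (1 / α)) (𝓝[>] 0) (𝓝[>] 0) := by
    refine tendsto_nhdsWithin_iff.2 ⟨?_, ?_⟩
    · have h1 : Tendsto (fun ε : ℝ => (ε / c) ^ (1 / α)) (𝓝 0) (𝓝 ((0 / c) ^ (1 / α))) :=
        ((continuous_id.div_const c).rpow_const fun _ => Or.inr (by positivity)).tendsto 0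
      rw [zero_div, Real.zero_rpow (by positivity)] at h1
      exact h1.mono_left nhdsWithin_le_nhds
    · filter_upwards [self_mem_nhdsWithin] with ε hε
      exact Real.rpow_pos_of_pos (div_pos hε hc) _
  refine ((hR.comp hh).const_mul (2 * c ^ (1 / α))).congr' ?_
  filter_upwards [self_mem_nhdsWithin] with ε hε
  have hε : 0 < ε := hε
  have hterm : ∀ k : ℕ, ((ε / c) ^ (1 / α) * ((k : ℝ) + 1)) ^ (-α) = c * ((k : ℝ) + 1) ^ (-α) / ε :=
    fun k => by
      rw [Real.mul_rpow (by positivity) (by positivity), ← Real.rpow_mul (by positivity),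
        show 1 / α * -α = -1 by field_simp, Real.rpow_neg_one]
      field_simp
  simp only [Function.comp_apply, hterm, ← perturbation_eq_one_div hε]
  rw [← tsum_mul_left, ← tsum_mul_left, ← tsum_div_const]
  congr 1; ext k
  rw [Real.rpow_sub hε, Real.rpow_one, Real.div_rpow hε.le hc.le]
  have h1 : 0 < c ^ (1 / α) := by positivity
  have h2 : 0 < ε ^ (1 / α) := by positivity
  field_simp

end Perturbation

theorem mainTheorem7 {H : Type*} [NormedAddCommGroup H] [InnerProductSpace ℝ H] [CompleteSpace H]
    [SecondCountableTopology H] [MeasurableSpace H] [BorelSpace H]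
    (A : H →L[ℝ] H) (hA : IsPositiveTraceClass A)
    (c α : ℝ) (hc : 0 < c) (hα : 1 < α)
    (heig : HasEigenvalueSequence A fun k : ℕ => c * ((k : ℝ) + 1) ^ (-α))
    (μ : Measure H) (hμ : IsCenteredGaussian μ A) :
    (∀ ε : ℝ, 0 < ε → ∃! π : Measure (H × H), IsEOTCoupling ε μ μ π) ∧
    (∃! π₀ : Measure (H × H), IsOTCoupling μ μ π₀) ∧
    IntegrableOn (fun t : ℝ => t ^ (-α) * perturbation 1 (t ^ (-α))) (Ioi 0) ∧
    0 < 2 * c ^ (1 / α) * ∫ t in Ioi (0 : ℝ), t ^ (-α) * perturbation 1 (t ^ (-α)) ∧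
    ∀ (π : ℝ → Measure (H × H)) (π₀ : Measure (H × H)),
      (∀ ε : ℝ, 0 < ε → IsEOTCoupling ε μ μ (π ε)) → IsOTCoupling μ μ π₀ →
      Tendsto (fun ε : ℝ => (wasserstein2Prod (π ε) π₀).toReal ^ 2 / ε ^ (1 - 1 / α)) (𝓝[>] 0)
        (𝓝 (2 * c ^ (1 / α) * ∫ t in Ioi (0 : ℝ), t ^ (-α) * perturbation 1 (t ^ (-α)))) := by
  obtain ⟨e, he, hAe, hA0⟩ := heig
  have hsum : Summable fun k : ℕ => c * ((k : ℝ) + 1) ^ (-α) := by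
    have h1 := (summable_nat_add_iff 1).2 (Real.summable_nat_rpow.2 (neg_lt_neg hα))
    simpa using h1.mul_left c
  have h : IsDiagonalGaussian e (fun k : ℕ => c * ((k : ℝ) + 1) ^ (-α)) μ :=
    hμ.isDiagonalGaussian he hAe hA0 (fun k => by positivity) hsum
  refine ⟨fun ε hε => ⟨h.eotCoupling hε, h.eotCoupling_isEOTCoupling hε,
    fun π hπ => h.eq_eotCoupling hε hπ⟩, ⟨_, diag_isOTCoupling, fun π hπ => hπ.eq_diag⟩,
    integrableOn_rpow_mul_perturbation hα,
    mul_pos (by positivity) (integral_rpow_mul_perturbation_pos hα), fun π π₀ hπ hπ₀ => ?_⟩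
  refine (tendsto_tsum_perturbation hc hα).congr' ?_
  filter_upwards [self_mem_nhdsWithin] with ε hε
  rw [h.eq_eotCoupling hε (hπ ε hε), hπ₀.eq_diag, h.wasserstein2Prod_eotCoupling_diag hε]
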